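/- Let $\mathfrak X$ be a countably infinite alphabet that contains pairwise distinct letters $x,y,t$ and $z_i,y_i,t_i$ ($i\ge 1$), and let $\mathfrak X^*$ be the free monoid over $\mathfrak X$. A letter is simple (multiple) in a word if it occurs in it exactly once (at least twice). For $\mathbf u,\mathbf v\in\mathfrak X^*$ put $\mathbf u\mathrel{\lambda}\mathbf v$ if and only if (1) the same letters are simple in $\mathbf u$ and in $\mathbf v$; (2) $\mathbf u$ can be obtained from $\mathbf v$ by changing the (positive) exponents of the maximal powers of letters in $\mathbf v$; and (3) for each multiple letter, its first two occurrences are adjacent in $\mathbf u$ if and only if they are adjacent in $\mathbf v$. This is a congruence on $\mathfrak X^*$; let $[\mathbf w]^\lambda$ denote the $\lambda$-class of the word $\mathbf w$. For a $\lambda$-class $\mathtt w$, let $M_\lambda(\mathtt w)$ be the Rees quotient of the monoid $\mathfrak X^*/\lambda$ over the ideal of all elements that are not factors of $\mathtt w$ (an element $\mathtt v$ is a factor of $\mathtt w$ if $\mathtt w=\mathtt p\mathtt v\mathtt s$ for some $\mathtt p,\mathtt s\in\mathfrak X^*/\lambda$), and let $\mathbf M_\lambda(\mathtt w)$ be the monoid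 variety generated by $M_\lambda(\mathtt w)$. For an integer $n\ge 1$ and a permutation $\rho$ of $\{1,\dots,n\}$, written $i\mapsto i\rho$, put \[ \mathbf c_{0,0,n}[\rho]:=xyt\,x\biggl(\prod_{i=1}^{n-1} z_{i\rho}y_i^2\biggr)z_{n\rho}\,y\biggl(\prod_{i=1}^{n} t_iz_i\biggr). \] **Proposition.** For every integer $n\ge 1$ and every $\rho\in S_n$, the lattice of subvarieties of the variety $\mathbf M_\lambda([\mathbf c_{0,0,n}[\rho]]^\lambda)$ is not modular. -/

import Mathlib

/-! ### Words -/

/-- The countably infinite alphabet, with letters `x, y, t` and `z_i, y_i, t_i` for `i : ℕ`. -/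
inductive Letter : Type
  | x : Letter
  | y : Letter
  | t : Letter
  | z_ (i : ℕ) : Letter
  | y_ (i : ℕ) : Letter
  | t_ (i : ℕ) : Letter
  deriving DecidableEq

instance : Infinite Letter :=
  Infinite.of_injective Letter.z_ fun _ _ h => Letter.z_.inj h

instance : Countable Letter := by
  let f : Letter → ℕ × ℕ := fun a => match a with
    | .x => (0, 0)
    | .y => (1, 0)
    | .t => (2, 0)
    | .z_ i => (3, i)
    | .y_ i => (4, i)
    | .t_ i => (5, i)
  have hf : Function.Injective f := by
    intro a b h
    cases a <;> cases b <;> simp_all [f]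
  exact hf.countable

/-- Words over the alphabet; the empty word is `1`. -/
abbrev Word : Type := FreeMonoid Letter

/-! ### Varieties of monoids -/

/-- The monoid `M` satisfies the identity `e.1 ≈ e.2`. -/
def SatisfiesIdentity (M : Type) [Monoid M] (e : Word × Word) : Prop :=
  ∀ φ : Letter → M, FreeMonoid.lift φ e.1 = FreeMonoid.lift φ e.2

/-- A variety of monoids: a class of monoids that is given by a set of identities. -/
@[ext]
structure MonoidVariety where
  carrier : Set MonCat.{0}
  equational : ∃ E : Set (Word × Word),
    carrier = {M : MonCat.{0} | ∀ e ∈ E, SatisfiesIdentity M e}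

namespace MonoidVariety

/-- Varieties are ordered by inclusion. -/
instance : PartialOrder MonoidVariety :=
  PartialOrder.lift MonoidVariety.carrier fun _ _ h => MonoidVariety.ext h

/-- The intersection of a family of varieties is a variety. -/
instance : InfSet MonoidVariety where
  sInf S :=
    { carrier := {M | ∀ V ∈ S, M ∈ V.carrier}
      equational := by
        refine ⟨{e | ∃ V ∈ S, ∀ M ∈ V.carrier, SatisfiesIdentity M e}, ?_⟩
        ext M
        constructor
        · rintro hM e ⟨V, hV, he⟩
          exact he M (hM V hV)
        · intro hM V hV
          obtain ⟨E, hE⟩ := V.equational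
          rw [hE]
          intro e he
          refine hM e ⟨V, hV, fun N hN => ?_⟩
          rw [hE] at hN
          exact hN e he }

/-- The lattice of all varieties of monoids: the meet is the intersection, and the join of two
varieties is the least variety that contains both. -/
instance : CompleteLattice MonoidVariety :=
  completeLatticeOfInf MonoidVariety fun _ =>
    ⟨fun _ hV _ hM => hM _ hV, fun _ hW _ hM _ hV => hW hV hM⟩

/-- The variety generated by a monoid, i.e. the least variety that contains it. -/
def generatedBy (M : Type) [Monoid M] : MonoidVariety :=
  sInf {V | MonCat.of M ∈ V.carrier}

/-- The lattice of subvarieties of a variety. -/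
abbrev SubvarietyLattice (V : MonoidVariety) : Type 1 := Set.Iic V

end MonoidVariety

/-! ### Rees quotients and the monoids `M_α(W)` -/

/-- The Rees congruence of a two-sided ideal `I` of a monoid `Q`: the elements of `I` are
identified with each other, and nothing else is. -/
def reesCon {Q : Type} [Monoid Q] (I : Set Q) (hI : ∀ a ∈ I, ∀ p s : Q, p * a * s ∈ I) :
    Con Q where
  r a b := a = b ∨ (a ∈ I ∧ b ∈ I)
  iseqv :=
    { refl := fun _ => Or.inl rfl
      symm := by
        rintro a b (h | h)
        · exact Or.inl h.symm
        · exact Or.inr h.symm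
      trans := by
        rintro a b c (rfl | h) (rfl | h')
        · exact Or.inl rfl
        · exact Or.inr h'
        · exact Or.inr h
        · exact Or.inr ⟨h.1, h'.2⟩ }
  mul' := by
    have hl : ∀ a ∈ I, ∀ p, p * a ∈ I := fun a ha p => by simpa using hI a ha p 1
    have hr : ∀ a ∈ I, ∀ s, a * s ∈ I := fun a ha s => by simpa using hI a ha 1 s
    rintro a b c d (rfl | h) (rfl | h')
    · exact Or.inl rfl
    · exact Or.inr ⟨hl _ h'.1 _, hl _ h'.2 _⟩
    · exact Or.inr ⟨hr _ h.1 _, hr _ h.2 _⟩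
    · exact Or.inr ⟨hr _ h.1 _, hr _ h.2 _⟩

/-- The set `W^≤` of all factors of elements of `W`. -/
def factorClosure {Q : Type} [Monoid Q] (W : Set Q) : Set Q :=
  {v | ∃ u ∈ W, ∃ p s : Q, u = p * v * s}

theorem compl_factorClosure_ideal {Q : Type} [Monoid Q] (W : Set Q) :
    ∀ a ∈ (factorClosure W)ᶜ, ∀ p s : Q, p * a * s ∈ (factorClosure W)ᶜ := by
  rintro a ha p s ⟨u, hu, p', s', rfl⟩
  exact ha ⟨_, hu, p' * p, s * s', by simp only [mul_assoc]⟩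

/-- The monoid `M_α(W)`, where `α` is a congruence on the free monoid and `W` is a set of
`α`-classes: the Rees quotient of the monoid of `α`-classes by the ideal of those `α`-classes
that are not factors of elements of `W`. -/
abbrev MAlpha (α : Con Word) (W : Set α.Quotient) : Type :=
  (reesCon (factorClosure W)ᶜ (compl_factorClosure_ideal W)).Quotient

/-! ### The congruence `λ` -/

/-- The relation `γ`: the same letters are simple (occur exactly once) in `u` and in `v`, and `u`
is obtained from `v` by changing the exponents of the maximal powers of letters, i.e. `u` and `v`
become equal when each maximal block `a ⋯ a` of equal letters is replaced by a single `a`. -/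
def GammaRel (u v : Word) : Prop :=
  (∀ a : Letter, u.toList.count a = 1 ↔ v.toList.count a = 1) ∧
    u.toList.destutter (· ≠ ·) = v.toList.destutter (· ≠ ·)

/-- The letter `a` is multiple in `l` and its first two occurrences in `l` are adjacent. -/
def FirstTwoAdjacent (a : Letter) (l : List Letter) : Prop :=
  ∃ p s : List Letter, a ∉ p ∧ l = p ++ a :: a :: s

/-- The relation `λ`. (Words that are in relation `γ` have the same multiple letters.) -/
def LambdaRel (u v : Word) : Prop :=
  GammaRel u v ∧ ∀ a : Letter, FirstTwoAdjacent a u.toList ↔ FirstTwoAdjacent a v.toList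

theorem destutter_ne_cons (a : Letter) (l : List Letter) :
    (a :: l).destutter (· ≠ ·) =
      if l.head? = some a then l.destutter (· ≠ ·) else a :: l.destutter (· ≠ ·) := by
  cases l with
  | nil => simp
  | cons b l =>
    rw [List.destutter_cons_cons, List.destutter_cons']
    by_cases h : a = b
    · subst h; simp
    · simp [h, Ne.symm h]

theorem head?_destutter_ne (l : List Letter) :
    (l.destutter (· ≠ ·)).head? = l.head? := by
  induction l with
  | nil => simp
  | cons a l ih =>
    rw [destutter_ne_cons]
    split_ifs with h
    · rw [ih, h]; simp
    · simp

theorem getLast?_destutter_ne (l : List Letter) :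
    (l.destutter (· ≠ ·)).getLast? = l.getLast? := by
  induction l with
  | nil => simp
  | cons a l ih =>
    rw [destutter_ne_cons]
    split_ifs with h
    · cases l with
      | nil => simp at h
      | cons b l => rw [ih, List.getLast?_cons_cons]
    · rw [List.getLast?_cons, List.getLast?_cons, ih]

theorem mem_destutter_ne (a : Letter) (l : List Letter) :
    a ∈ l.destutter (· ≠ ·) ↔ a ∈ l := by
  induction l with
  | nil => simp
  | cons b l ih =>
    rw [destutter_ne_cons]
    split_ifs with h
    · have hb : b ∈ l := List.mem_of_mem_head? h
      rw [ih, List.mem_cons]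
      constructor
      · exact Or.inr
      · rintro (rfl | h') <;> assumption
    · rw [List.mem_cons, List.mem_cons, ih]

theorem destutter_ne_append_right (u : List Letter) {v w : List Letter}
    (h : v.destutter (· ≠ ·) = w.destutter (· ≠ ·)) :
    (u ++ v).destutter (· ≠ ·) = (u ++ w).destutter (· ≠ ·) := by
  induction u with
  | nil => simpa using h
  | cons a u ih =>
    rw [List.cons_append, List.cons_append, destutter_ne_cons, destutter_ne_cons, ih,
      ← head?_destutter_ne (u ++ v), ih, head?_destutter_ne]

theorem destutter_ne_append_left (u w : List Letter) :
    (u ++ w).destutter (· ≠ ·) = (u.destutter (· ≠ ·) ++ w).destutter (· ≠ ·) := by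
  induction u with
  | nil => simp
  | cons a u ih =>
    have h1 : ((a :: u) ++ w).destutter (· ≠ ·) =
        (a :: (u.destutter (· ≠ ·) ++ w)).destutter (· ≠ ·) :=
      destutter_ne_append_right [a] ih
    rw [h1, destutter_ne_cons a u]
    split_ifs with h
    · rw [destutter_ne_cons, if_pos]
      rw [List.head?_append, head?_destutter_ne, h]
      rfl
    · rfl

theorem firstTwoAdjacent_append (a : Letter) (u w : List Letter) :
    FirstTwoAdjacent a (u ++ w) ↔
      FirstTwoAdjacent a u ∨
      (u.count a = 1 ∧ u.getLast? = some a ∧ w.head? = some a) ∨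
      (a ∉ u ∧ FirstTwoAdjacent a w) := by
  induction u with
  | nil => simp [FirstTwoAdjacent]
  | cons b u ih =>
    have key : ∀ l : List Letter, FirstTwoAdjacent a (b :: l) ↔
        (b = a ∧ l.head? = some a) ∨ (b ≠ a ∧ FirstTwoAdjacent a l) := by
      intro l
      constructor
      · rintro ⟨p, s, hp, h⟩
        cases p with
        | nil =>
          simp only [List.nil_append, List.cons.injEq] at h
          exact Or.inl ⟨h.1, by rw [h.2]; rfl⟩
        | cons c p =>
          simp only [List.cons_append, List.cons.injEq] at h
          simp only [List.mem_cons, not_or] at hp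
          exact Or.inr ⟨h.1 ▸ Ne.symm hp.1, p, s, hp.2, h.2⟩
      · rintro (⟨rfl, h⟩ | ⟨hb, p, s, hp, rfl⟩)
        · obtain ⟨s, rfl⟩ := List.head?_eq_some_iff.1 h
          exact ⟨[], s, by simp, rfl⟩
        · exact ⟨b :: p, s, by simp [hp, Ne.symm hb], rfl⟩
    rw [List.cons_append, key, key, ih]
    by_cases hb : b = a
    · subst hb
      cases u with
      | nil => simp
      | cons c u =>
        simp only [List.count_cons_self, List.getLast?_cons_cons, List.head?_cons,
          List.cons_append, List.mem_cons, true_or, not_true_eq_false, false_and, or_false,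
          ne_eq, true_and, iff_self_or, and_imp]
        intro h1 h2
        have h3 : b ∈ c :: u := List.mem_of_getLast? h2
        have h4 := List.count_pos_iff.2 h3
        omega
    · cases u with
      | nil => simp [hb, Ne.symm hb, FirstTwoAdjacent]
      | cons c u => simp [hb, Ne.symm hb, List.count_cons]

/-- The congruence `λ` on the free monoid. -/
def lambdaCon : Con Word where
  r := LambdaRel
  iseqv :=
    { refl := fun _ => ⟨⟨fun _ => Iff.rfl, rfl⟩, fun _ => Iff.rfl⟩
      symm := fun h => ⟨⟨fun a => (h.1.1 a).symm, h.1.2.symm⟩, fun a => (h.2 a).symm⟩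
      trans := fun h h' => ⟨⟨fun a => (h.1.1 a).trans (h'.1.1 a), h.1.2.trans h'.1.2⟩,
        fun a => (h.2 a).trans (h'.2 a)⟩ }
  mul' := by
    rintro u v u' v' ⟨⟨h1, h2⟩, h3⟩ ⟨⟨h1', h2'⟩, h3'⟩
    have hm : ∀ a, a ∈ u.toList ↔ a ∈ v.toList := fun a => by
      rw [← mem_destutter_ne, h2, mem_destutter_ne]
    have hm' : ∀ a, a ∈ u'.toList ↔ a ∈ v'.toList := fun a => by
      rw [← mem_destutter_ne, h2', mem_destutter_ne]
    have hl : u.toList.getLast? = v.toList.getLast? := by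
      rw [← getLast?_destutter_ne, h2, getLast?_destutter_ne]
    have hh : u'.toList.head? = v'.toList.head? := by
      rw [← head?_destutter_ne, h2', head?_destutter_ne]
    refine ⟨⟨fun a => ?_, ?_⟩, fun a => ?_⟩
    · have e1 := h1 a
      have e2 := h1' a
      have e3 := hm a
      have e4 := hm' a
      rw [← List.count_pos_iff, ← List.count_pos_iff] at e3 e4
      rw [FreeMonoid.toList_mul, FreeMonoid.toList_mul, List.count_append, List.count_append]
      omega
    · rw [FreeMonoid.toList_mul, FreeMonoid.toList_mul, destutter_ne_append_left, h2,
        ← destutter_ne_append_left]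
      exact destutter_ne_append_right _ h2'
    · rw [FreeMonoid.toList_mul, FreeMonoid.toList_mul, firstTwoAdjacent_append,
        firstTwoAdjacent_append, h3 a, h1 a, hl, hh, hm a, h3' a]

/-- The variety generated by the monoid `M_λ([w]^λ)`. -/
def varMLambda (w : Word) : MonoidVariety :=
  MonoidVariety.generatedBy (MAlpha lambdaCon {(w : lambdaCon.Quotient)})

/-! ### The words `c_{0,0,n}[ρ]` -/

/-- The symmetric group on the set `{1, …, n}`. -/
abbrev SymGroup (n : ℕ) : Type := Equiv.Perm {i : ℕ // 1 ≤ i ∧ i ≤ n}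

/-- The one-letter word `z_i`. -/
def zLetter (i : ℕ) : Word := FreeMonoid.of (Letter.z_ i)

/-- The one-letter word `y_i`. -/
def yLetter (i : ℕ) : Word := FreeMonoid.of (Letter.y_ i)

/-- The one-letter word `t_i`. -/
def tLetter (i : ℕ) : Word := FreeMonoid.of (Letter.t_ i)

/-- The word `x y t x (∏_{i=1}^{n-1} z_{iρ} y_i²) z_{nρ} y (∏_{i=1}^{n} t_i z_i)` for `n ≥ 1`.
The permutation `ρ` of `{1, …, n}` is extended to `ℕ` by fixing all other numbers, and
`List.range' 1 m` is the list `[1, …, m]`. -/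
def cWord (n : ℕ) (ρ : SymGroup n) : Word :=
  let r : ℕ → ℕ := Equiv.Perm.ofSubtype ρ
  FreeMonoid.of Letter.x * FreeMonoid.of Letter.y * FreeMonoid.of Letter.t *
    FreeMonoid.of Letter.x *
    ((List.range' 1 (n - 1)).map fun i => zLetter (r i) * yLetter i ^ 2).prod *
    zLetter (r n) * FreeMonoid.of Letter.y *
    ((List.range' 1 n).map fun i => tLetter i * zLetter i).prod

/-! Write c for the word `c_{0,0,n}[ρ]`. The modular law fails for three subvarieties generated by
syntactic monoids. A test maps words over a doubled alphabet to words, and a word passes if its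
image lies in the `λ`-class of c. The words that pass a family of tests form a language whose
syntactic monoid lies in the given variety (`syntacticCon_passSet_mem_varMLambda`). Let FA consist
of the projection to the first copy of the alphabet and of certain guard tests, FB of the projection
to the second copy and the same guard tests. Let VB, VC and VN be the varieties obtained from FA, FB
and FA ∪ FB.

Let E(i,j) be a word that interleaves two copies of c, where i and j tell whether the initial xy of
the first copy and x'y' of the second are reversed (1) or not (0). Then VC satisfies E(0,j) ≈
E(1,j), VB satisfies E(i,0) ≈ E(i,1), and VN satisfies E(0,1) ≈ E(1,1). So VB ∧ (VC ∨ VN) satisfies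
E(0,0) ≈ E(0,1) ≈ E(1,1) ≈ E(1,0), and VC ∨ (VB ∧ (VC ∨ VN)) satisfies E(0,0) ≈ E(1,0). Since VN
lies in VC ∨ VB, the modular law would place VN in that join; but VN violates E(0,0) ≈ E(1,0),
because E(0,0) passes all tests while the first projection of E(1,0) contains the scattered subword
yxt, which c does not.

The identities rest on a rigidity of c (`IsCBlock.eq_x_and_eq_y`): if P(XY)QXBYS lies in the class
of c and all letters of B are multiple in it, then distinct letters of X and Y can only be x in X
and y in Y. Hence interchanging the first X and Y matters only for such a critical pair. Guard tests
never meet a critical pair, so they are invariant under the interchange; yet they control the order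
of the letters well enough (`Guarded.facts_of_head` and its companions) that
`SwapConfig.mem_blocker` excludes critical pairs for the projections wherever the identities above
require it. The delicate case is E(0,1) ≈ E(1,1), treated in
`SwapConfig.not_critical_projA_of_projB`, where the reversal of x'y' is essential. -/

section

open scoped List

/-! ### Sublists -/

theorem List.cons_sublist_append_of_mem {α : Type*} {a : α} {p A B : List α} (ha : a ∈ A)
    (hp : p <+ B) : a :: p <+ A ++ B :=
  (List.singleton_sublist.2 ha).append hp

theorem List.sublist_append_skip {α : Type*} {p B : List α} (A : List α) (hp : p <+ B) :
    p <+ A ++ B :=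
  hp.trans (List.sublist_append_right A B)

theorem List.Sublist.of_cons_append {α : Type*} {a : α} {p A B : List α}
    (h : a :: p <+ A ++ B) (ha : a ∉ A) : a :: p <+ B := by
  induction A with
  | nil => exact h
  | cons b A ih =>
    simp only [List.mem_cons, not_or] at ha
    rw [List.cons_append, List.cons_sublist_cons'] at h
    rcases h with h | h
    · exact ih h ha.2
    · exact absurd h.1 ha.1

theorem List.Sublist.of_cons_ne {α : Type*} {a b : α} {p B : List α}
    (h : a :: p <+ b :: B) (hab : a ≠ b) : a :: p <+ B :=
  List.Sublist.of_cons_append (A := [b]) h (by simpa using hab)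

theorem List.Sublist.tail_of_cons {α : Type*} {a : α} {p B : List α}
    (h : a :: p <+ B) : p <+ B :=
  (List.sublist_cons_self a p).trans h

theorem List.exists_pair_sublist {α : Type*} {a b : α} {l : List α} (hab : a ≠ b)
    (ha : a ∈ l) (hb : b ∈ l) : [a, b] <+ l ∨ [b, a] <+ l := by
  obtain ⟨s, t, rfl⟩ := List.append_of_mem ha
  rcases List.mem_append.1 hb with h | h
  · exact Or.inr (List.cons_sublist_append_of_mem h (by simp))
  · rw [List.mem_cons] at h
    rcases h with h | h
    · exact absurd h.symm hab
    · exact Or.inl (List.sublist_append_skip _ (by simpa using h))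

/-- If both lists are nonempty, they are powers of one and the same letter. -/
theorem List.append_comm_of_forall_eq {α : Type*} {X Y : List α}
    (h : ∀ c ∈ X, ∀ d ∈ Y, c = d) : X ++ Y = Y ++ X := by
  cases X with
  | nil => simp
  | cons a X =>
    cases Y with
    | nil => simp
    | cons b Y =>
      have hab : a = b := h a (by simp) b (by simp)
      have hX : a :: X = List.replicate (X.length + 1) a :=
        List.eq_replicate_iff.2 ⟨by simp, fun c hc => (h c hc b (by simp)).trans hab.symm⟩
      have hY : b :: Y = List.replicate (Y.length + 1) a :=
        List.eq_replicate_iff.2 ⟨by simp, fun c hc => (h a (by simp) c hc).symm⟩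
      rw [hX, hY, List.replicate_append_replicate, List.replicate_append_replicate, add_comm]

theorem List.mem_flatMap_sublist_pair {α β : Type*} {f : α → List β} {c d : β} {l : List α}
    (h : [c, d] <+ l.flatMap f) :
    (∃ g k, c ∈ f g ∧ d ∈ f k ∧ [g, k] <+ l) ∨ ∃ g ∈ l, [c, d] <+ f g := by
  induction l with
  | nil => simp at h
  | cons a l ih =>
    rw [List.flatMap_cons] at h
    obtain ⟨p, q, hpq, hp, hq⟩ := List.sublist_append_iff.1 h
    rcases p with _ | ⟨c', p⟩
    · simp only [List.nil_append] at hpq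
      subst hpq
      rcases ih hq with ⟨g, k, h1, h2, h3⟩ | ⟨g, h1, h2⟩
      · exact Or.inl ⟨g, k, h1, h2, h3.trans (List.sublist_cons_self _ _)⟩
      · exact Or.inr ⟨g, by simp [h1], h2⟩
    rcases p with _ | ⟨d', p⟩
    · simp only [List.cons_append, List.nil_append, List.cons.injEq] at hpq
      obtain ⟨rfl, rfl⟩ := hpq
      obtain ⟨k, hk, hk'⟩ := List.mem_flatMap.1 (List.singleton_sublist.1 hq)
      exact Or.inl ⟨a, k, List.singleton_sublist.1 hp, hk', by simpa using hk⟩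
    · simp only [List.cons_append, List.cons.injEq, List.nil_eq, List.append_eq_nil_iff] at hpq
      obtain ⟨rfl, rfl, rfl, rfl⟩ := hpq
      exact Or.inr ⟨a, by simp, hp⟩

theorem List.map_sublist_flatMap {α β : Type*} {f : α → List β} {ι : β → α}
    (hf : ∀ b, f (ι b) = [b]) {p : List β} {l : List α} (h : p.map ι <+ l) :
    p <+ l.flatMap f := by
  have := h.flatMap f
  simpa [List.flatMap_map, hf] using this

theorem List.count_flatMap_pos_two {α β : Type*} [DecidableEq α] [DecidableEq β]
    {f : α → List β} {g : α} {c : β} {l : List α} (hg : 2 ≤ l.count g) (hc : c ∈ f g) :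
    2 ≤ (l.flatMap f).count c := by
  have h1 : List.replicate 2 g <+ l := List.replicate_sublist_iff.2 hg
  have h2 := (h1.flatMap f).count_le c
  have h3 : 0 < (f g).count c := List.count_pos_iff.2 hc
  have h4 : ((List.replicate 2 g).flatMap f).count c = (f g).count c + (f g).count c := by
    simp [List.replicate]
  omega

/-! ### Words in relation `λ`, as lists -/

/-- A block of equal letters contributes at most one letter to a subword without equal neighbours,
so collapsing blocks loses nothing. -/
theorem List.Sublist.destutter_ne {p l : List Letter} (hp : p.IsChain (· ≠ ·)) (h : p <+ l) :
    p <+ l.destutter (· ≠ ·) := by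
  induction l generalizing p with
  | nil => simpa using h
  | cons a l ih =>
    rw [destutter_ne_cons]
    rw [List.sublist_cons_iff] at h
    split_ifs with ha
    · obtain ⟨s, rfl⟩ := List.head?_eq_some_iff.1 ha
      rcases h with h | ⟨r, rfl, h⟩
      · exact ih hp h
      · refine ih hp ?_
        rcases r with _ | ⟨b, r⟩
        · simp
        · have hab : b ≠ a := by
            have := (List.isChain_cons_cons.1 hp).1
            exact this.symm
          exact (h.of_cons_ne hab).cons_cons a
    · rcases h with h | ⟨r, rfl, h⟩
      · exact (ih hp h).trans (List.sublist_cons_self _ _)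
      · exact (ih hp.of_cons h).cons_cons a

/-- Subwords with equal neighbours are not preserved by `λ`. Here a square at the front gets a
separator: the letter right after the first `a` differs from `a`, and the rest of the subword still
fits behind it. -/
theorem exists_sublist_of_not_firstTwoAdjacent {a : Letter} {L p : List Letter}
    (h : ¬ FirstTwoAdjacent a L) (hp : a :: a :: p <+ L) :
    ∃ c, c ≠ a ∧ a :: c :: a :: p <+ L := by
  have ha : a ∈ L := hp.subset (by simp)
  obtain ⟨q, s, rfl, hq⟩ := List.eq_append_cons_of_mem ha
  have h1 := List.cons_sublist_cons.1 (hp.of_cons_append hq)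
  rcases s with _ | ⟨c, s⟩
  · simp at h1
  · by_cases hc : c = a
    · subst hc
      exact absurd ⟨q, s, hq, rfl⟩ h
    · exact ⟨c, hc, List.sublist_append_skip _
        (((h1.of_cons_ne (Ne.symm hc)).cons_cons c).cons_cons a)⟩

/-- The relation `λ` for lists of letters. -/
def ListLambda (L D : List Letter) : Prop :=
  LambdaRel (FreeMonoid.ofList L) (FreeMonoid.ofList D)

namespace ListLambda

variable {L D p : List Letter}

theorem symm (h : ListLambda L D) : ListLambda D L := lambdaCon.symm h

/-- The main tool for comparing a word with c: scattered subwords without equal neighbours are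
invariants of the `λ`-class. -/
theorem sublist (h : ListLambda L D) (hp : p.IsChain (· ≠ ·)) (hL : p <+ L) : p <+ D := by
  have h1 := hL.destutter_ne hp
  have h2 : L.destutter (· ≠ ·) = D.destutter (· ≠ ·) := h.1.2
  rw [h2] at h1
  exact h1.trans (List.destutter_sublist _ _)

theorem mem_iff (h : ListLambda L D) (a : Letter) : a ∈ L ↔ a ∈ D := by
  have h2 : L.destutter (· ≠ ·) = D.destutter (· ≠ ·) := h.1.2
  rw [← mem_destutter_ne, h2, mem_destutter_ne]

theorem count_eq_one (h : ListLambda L D) {a : Letter} (ha : D.count a = 1) : L.count a = 1 :=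
  (h.1.1 a).2 ha

theorem not_firstTwoAdjacent (h : ListLambda L D) {a : Letter} (ha : ¬ FirstTwoAdjacent a D) :
    ¬ FirstTwoAdjacent a L := fun hL => ha ((h.2 a).1 hL)

end ListLambda

end

section

open scoped List

/-! ### The shape of the words `c_{0,0,n}[ρ]` -/

/-- The combinatorial properties of the two blocks `R` and `T` of the word
`c_{0,0,n}[ρ] = xytx R y T` that are used below. -/
structure IsCBlock (n : ℕ) (R T : List Letter) : Prop where
  memR : ∀ c ∈ R, (∃ i, 1 ≤ i ∧ i ≤ n ∧ c = Letter.z_ i) ∨ ∃ k, 1 ≤ k ∧ k < n ∧ c = Letter.y_ k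
  memT : ∀ c ∈ T, ∃ i, 1 ≤ i ∧ i ≤ n ∧ (c = Letter.t_ i ∨ c = Letter.z_ i)
  splitZ : ∀ i, 1 ≤ i → i ≤ n →
    ∃ A B, R = A ++ Letter.z_ i :: B ∧ Letter.z_ i ∉ A ∧ Letter.z_ i ∉ B
  splitY : ∀ k, 1 ≤ k → k < n → ∃ A B, R = A ++ Letter.y_ k :: Letter.y_ k :: B ∧
    Letter.y_ k ∉ A ∧ Letter.y_ k ∉ B
  splitT : ∀ i, 1 ≤ i → i ≤ n → ∃ A B, T = A ++ Letter.t_ i :: Letter.z_ i :: B ∧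
    Letter.z_ i ∉ A ∧ Letter.z_ i ∉ B ∧ Letter.t_ i ∉ A ∧ Letter.t_ i ∉ B
  headR : ∃ f R', 1 ≤ f ∧ f ≤ n ∧ R = Letter.z_ f :: R'
  lastR : ∃ l R', 1 ≤ l ∧ l ≤ n ∧ R = R' ++ [Letter.z_ l]
  headT : ∃ T', T = Letter.t_ 1 :: T'

/-- The list `xytx R y T`. -/
def cList (R T : List Letter) : List Letter :=
  Letter.x :: Letter.y :: Letter.t :: Letter.x :: (R ++ Letter.y :: T)

theorem exists_isCBlock (n : ℕ) (hn : 1 ≤ n) (ρ : SymGroup n) :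
    ∃ R T, IsCBlock n R T ∧ (cWord n ρ).toList = cList R T := by
  obtain ⟨r, hr⟩ : ∃ r : Equiv.Perm ℕ, r = Equiv.Perm.ofSubtype ρ := ⟨_, rfl⟩
  have hmem : ∀ i, 1 ≤ i → i ≤ n → 1 ≤ r i ∧ r i ≤ n := by
    intro i h1 h2
    rw [hr, Equiv.Perm.ofSubtype_apply_of_mem (p := fun i => 1 ≤ i ∧ i ≤ n) ρ ⟨h1, h2⟩]
    exact (ρ ⟨i, h1, h2⟩).2
  have hsurj : ∀ i, 1 ≤ i → i ≤ n → ∃ j, 1 ≤ j ∧ j ≤ n ∧ r j = i := by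
    intro i h1 h2
    refine ⟨ρ.symm ⟨i, h1, h2⟩, (ρ.symm ⟨i, h1, h2⟩).2.1, (ρ.symm ⟨i, h1, h2⟩).2.2, ?_⟩
    rw [hr, Equiv.Perm.ofSubtype_apply_coe, Equiv.apply_symm_apply]
  have hne : ∀ {i j}, i ≠ j → r j ≠ r i := fun h h' => h (r.injective h').symm
  refine ⟨((List.range' 1 (n - 1)).flatMap fun i =>
      [Letter.z_ (r i), Letter.y_ i, Letter.y_ i]) ++ [Letter.z_ (r n)],
    (List.range' 1 n).flatMap fun i => [Letter.t_ i, Letter.z_ i], ?_, ?_⟩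
  · have hsplit : ∀ m j, 1 ≤ j → j ≤ m → ∃ A B, List.range' 1 m = A ++ j :: B ∧
        (∀ i ∈ A, i ≠ j) ∧ (∀ i ∈ B, i ≠ j) := by
      intro m j h1 h2
      obtain ⟨A, B, h⟩ := List.append_of_mem
        (show j ∈ List.range' 1 m from List.mem_range'_1.2 (by omega))
      have hnd : (List.range' 1 m).Nodup := List.nodup_range'
      rw [h, List.nodup_append] at hnd
      refine ⟨A, B, h, fun i hi => hnd.2.2 i hi j (by simp), fun i hi hij => ?_⟩
      subst hij
      exact (List.nodup_cons.1 hnd.2.1).1 hi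
    refine ⟨?_, ?_, ?_, ?_, ?_, ?_, ?_, ?_⟩
    · intro c hc
      simp only [List.mem_append, List.mem_flatMap, List.mem_range'_1, List.mem_cons,
        List.not_mem_nil, or_false] at hc
      rcases hc with ⟨i, hi, rfl | rfl | rfl⟩ | rfl
      · exact Or.inl ⟨r i, (hmem i hi.1 (by omega)).1, (hmem i hi.1 (by omega)).2, rfl⟩
      · exact Or.inr ⟨i, hi.1, by omega, rfl⟩
      · exact Or.inr ⟨i, hi.1, by omega, rfl⟩
      · exact Or.inl ⟨r n, (hmem n hn le_rfl).1, (hmem n hn le_rfl).2, rfl⟩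
    · intro c hc
      simp only [List.mem_flatMap, List.mem_range'_1, List.mem_cons,
        List.not_mem_nil, or_false] at hc
      obtain ⟨i, hi, h⟩ := hc
      exact ⟨i, hi.1, by omega, h⟩
    · intro i h1 h2
      obtain ⟨j, hj1, hj2, rfl⟩ := hsurj i h1 h2
      rcases hj2.lt_or_eq with hj | rfl
      · obtain ⟨A, B, h, hA, hB⟩ := hsplit (n - 1) j hj1 (by omega)
        rw [h]
        refine ⟨A.flatMap (fun i => [Letter.z_ (r i), Letter.y_ i, Letter.y_ i]),
          Letter.y_ j :: Letter.y_ j ::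
            (B.flatMap (fun i => [Letter.z_ (r i), Letter.y_ i, Letter.y_ i]) ++
              [Letter.z_ (r n)]),
          by simp, ?_, ?_⟩
        · simp only [List.mem_flatMap, List.mem_cons, Letter.z_.injEq, reduceCtorEq,
            List.not_mem_nil, or_false, not_exists, not_and]
          exact fun i hi => hne (hA i hi)
        · simp only [List.mem_append, List.mem_flatMap, List.mem_cons, Letter.z_.injEq,
            reduceCtorEq, List.not_mem_nil, or_false, false_or, not_or, not_exists, not_and]
          exact ⟨fun i hi => hne (hB i hi), hne (by omega)⟩
      · refine ⟨_, [], rfl, ?_, by simp⟩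
        simp only [List.mem_flatMap, List.mem_cons, Letter.z_.injEq, reduceCtorEq,
          List.not_mem_nil, or_false, not_exists, not_and, List.mem_range'_1]
        exact fun i hi => hne (by omega)
    · intro k h1 h2
      obtain ⟨A, B, h, hA, hB⟩ := hsplit (n - 1) k h1 (by omega)
      rw [h]
      refine ⟨A.flatMap (fun i => [Letter.z_ (r i), Letter.y_ i, Letter.y_ i]) ++
          [Letter.z_ (r k)],
        B.flatMap (fun i => [Letter.z_ (r i), Letter.y_ i, Letter.y_ i]) ++
          [Letter.z_ (r n)],
        by simp, ?_, ?_⟩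
      · simp only [List.mem_append, List.mem_flatMap, List.mem_cons, Letter.y_.injEq,
          reduceCtorEq, List.not_mem_nil, or_false, false_or, not_exists, not_and, or_self]
        exact fun i hi h => hA i hi h.symm
      · simp only [List.mem_append, List.mem_flatMap, List.mem_cons, Letter.y_.injEq,
          reduceCtorEq, List.not_mem_nil, or_false, false_or, not_exists, not_and, or_self]
        exact fun i hi h => hB i hi h.symm
    · intro i h1 h2
      obtain ⟨A, B, h, hA, hB⟩ := hsplit n i h1 h2
      rw [h]
      refine ⟨A.flatMap (fun i => [Letter.t_ i, Letter.z_ i]),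
        B.flatMap (fun i => [Letter.t_ i, Letter.z_ i]), by simp, ?_, ?_, ?_, ?_⟩ <;>
        simp only [List.mem_flatMap, List.mem_cons, Letter.z_.injEq, Letter.t_.injEq,
          reduceCtorEq, List.not_mem_nil, or_false, false_or, not_exists, not_and]
      · exact fun i hi h => hA i hi h.symm
      · exact fun i hi h => hB i hi h.symm
      · exact fun i hi h => hA i hi h.symm
      · exact fun i hi h => hB i hi h.symm
    · rcases Nat.exists_eq_add_of_le hn with ⟨m, rfl⟩
      rcases m with _ | m
      · exact ⟨r 1, [], (hmem 1 le_rfl le_rfl).1, (hmem 1 le_rfl le_rfl).2, by simp⟩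
      · rw [show 1 + (m + 1) - 1 = m + 1 by omega, List.range'_succ, List.flatMap_cons,
          List.cons_append, List.cons_append]
        exact ⟨r 1, _, (hmem 1 le_rfl hn).1, (hmem 1 le_rfl hn).2, rfl⟩
    · exact ⟨r n, _, (hmem n hn le_rfl).1, (hmem n hn le_rfl).2, rfl⟩
    · rcases Nat.exists_eq_add_of_le' hn with ⟨m, rfl⟩
      exact ⟨_, by rw [List.range'_succ, List.flatMap_cons, List.cons_append]⟩
  · simp only [cWord, ← hr, FreeMonoid.toList_mul, FreeMonoid.toList_of, FreeMonoid.toList_prod,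
      List.map_map, cList, zLetter, yLetter, tLetter, List.flatMap_def, Function.comp_def, pow_two]
    simp

namespace IsCBlock

variable {n : ℕ} {R T : List Letter}

theorem mem_cList (h : IsCBlock n R T) {c : Letter} (hc : c ∈ cList R T) :
    c = Letter.x ∨ c = Letter.y ∨ c = Letter.t ∨
      (∃ i, 1 ≤ i ∧ i ≤ n ∧ (c = Letter.z_ i ∨ c = Letter.t_ i)) ∨
      ∃ k, 1 ≤ k ∧ k < n ∧ c = Letter.y_ k := by
  simp only [cList, List.mem_cons, List.mem_append] at hc
  have h1 := h.memR c
  have h2 := h.memT c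
  grind

theorem x_notMem (h : IsCBlock n R T) : Letter.x ∉ R ++ Letter.y :: T := by
  have h1 := h.memR Letter.x
  have h2 := h.memT Letter.x
  simp at h1 h2
  simp [h1, h2]

theorem t_notMem (h : IsCBlock n R T) : Letter.t ∉ R ++ Letter.y :: T := by
  have h1 := h.memR Letter.t
  have h2 := h.memT Letter.t
  simp at h1 h2
  simp [h1, h2]

theorem y_notMem_left (h : IsCBlock n R T) : Letter.y ∉ R := by
  have h1 := h.memR Letter.y
  simpa using h1

theorem y_notMem_right (h : IsCBlock n R T) : Letter.y ∉ T := by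
  have h2 := h.memT Letter.y
  simpa using h2

theorem yIdx_notMem_right (h : IsCBlock n R T) (k : ℕ) : Letter.y_ k ∉ T := by
  have h2 := h.memT (Letter.y_ k)
  simpa using h2

theorem tIdx_notMem_left (h : IsCBlock n R T) (k : ℕ) : Letter.t_ k ∉ R := by
  have h1 := h.memR (Letter.t_ k)
  simpa using h1

theorem exists_splitZT (h : IsCBlock n R T) {i : ℕ} (h1 : 1 ≤ i) (h2 : i ≤ n) : ∃ A B C,
    cList R T = A ++ Letter.z_ i :: (B ++ Letter.t_ i :: Letter.z_ i :: C) ∧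
    Letter.z_ i ∉ A ∧ Letter.z_ i ∉ B ∧ Letter.z_ i ∉ C ∧
    Letter.t_ i ∉ A ∧ Letter.t_ i ∉ B ∧ Letter.t_ i ∉ C := by
  obtain ⟨A, B, hR, hA, hB⟩ := h.splitZ i h1 h2
  obtain ⟨A', B', hT, hA', hB', hA'', hB''⟩ := h.splitT i h1 h2
  have ht := h.tIdx_notMem_left i
  rw [hR] at ht
  simp only [List.mem_append, List.mem_cons, reduceCtorEq, false_or, not_or] at ht
  refine ⟨Letter.x :: Letter.y :: Letter.t :: Letter.x :: A, B ++ Letter.y :: A', B', ?_, ?_⟩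
  · simp [cList, hR, hT]
  · simp [*]

theorem exists_splitY (h : IsCBlock n R T) {k : ℕ} (h1 : 1 ≤ k) (h2 : k < n) : ∃ A B,
    cList R T = A ++ Letter.y_ k :: Letter.y_ k :: B ∧ Letter.y_ k ∉ A ∧ Letter.y_ k ∉ B := by
  obtain ⟨A, B, hR, hA, hB⟩ := h.splitY k h1 h2
  have ht := h.yIdx_notMem_right k
  refine ⟨Letter.x :: Letter.y :: Letter.t :: Letter.x :: A, B ++ Letter.y :: T, ?_, ?_⟩
  · simp [cList, hR]
  · simp [*]

/-! ### Simple letters of `xytx R y T` and scattered subwords that it contains or avoids -/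

theorem count_t (h : IsCBlock n R T) : (cList R T).count Letter.t = 1 := by
  have := List.count_eq_zero.2 h.t_notMem
  simp [cList, -List.count_append, this]

theorem count_t_ (h : IsCBlock n R T) {i : ℕ} (h1 : 1 ≤ i) (h2 : i ≤ n)
    : (cList R T).count (Letter.t_ i) = 1 := by
  obtain ⟨A, B, C, h3, -, -, -, hA, hB, hC⟩ := h.exists_splitZT h1 h2
  rw [h3]
  simp [List.count_eq_zero.2 hA, List.count_eq_zero.2 hB, List.count_eq_zero.2 hC]

theorem z_y_sublist (h : IsCBlock n R T) {i : ℕ} (h1 : 1 ≤ i) (h2 : i ≤ n) :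
    [Letter.z_ i, Letter.y] <+ cList R T := by
  obtain ⟨A, B, hR, hA, hB⟩ := h.splitZ i h1 h2
  have : cList R T = (Letter.x :: Letter.y :: Letter.t :: Letter.x :: R) ++ Letter.y :: T := by
    simp [cList]
  rw [this]
  exact List.cons_sublist_append_of_mem (by simp [hR]) (by simp)

theorem not_firstTwoAdjacent_y : ¬ FirstTwoAdjacent Letter.y (cList R T) := by
  rintro ⟨p, s, hp, h3⟩
  rcases p with _ | ⟨a, _ | ⟨b, p⟩⟩
  · simp [cList] at h3
  · simp [cList] at h3
  · simp only [cList, List.cons_append, List.cons.injEq] at h3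
    exact hp (by simp [← h3.2.1])

theorem not_z_c_z_y (h : IsCBlock n R T) {i : ℕ} (h1 : 1 ≤ i) (h2 : i ≤ n) {c : Letter} :
    ¬ [Letter.z_ i, c, Letter.z_ i, Letter.y] <+ cList R T := by
  obtain ⟨A, B, hR, hA, hB⟩ := h.splitZ i h1 h2
  intro h3
  have : cList R T = (Letter.x :: Letter.y :: Letter.t :: Letter.x :: A) ++
      Letter.z_ i :: (B ++ Letter.y :: T) := by
    simp [cList, hR]
  rw [this] at h3
  have h4 := (List.cons_sublist_cons.1 (h3.of_cons_append (by simp [hA]))).tail_of_cons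
  have h5 := ((h4.of_cons_append hB).of_cons_ne (by simp)).tail_of_cons
  exact h.y_notMem_right (List.singleton_sublist.1 h5)

theorem not_firstTwoAdjacent_z (h : IsCBlock n R T) {i : ℕ} (h1 : 1 ≤ i) (h2 : i ≤ n) :
    ¬ FirstTwoAdjacent (Letter.z_ i) (cList R T) := by
  obtain ⟨A, B, hR, hA, hB⟩ := h.splitZ i h1 h2
  have : cList R T = (Letter.x :: Letter.y :: Letter.t :: Letter.x :: A) ++
      Letter.z_ i :: (B ++ Letter.y :: T) := by
    simp [cList, hR]
  rw [this, firstTwoAdjacent_append]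
  simp only [List.mem_cons, reduceCtorEq, hA, false_or, not_false_eq_true, true_and, not_or]
  refine ⟨?_, ?_, ?_⟩
  · rintro ⟨p, s, -, h3⟩
    have : Letter.z_ i ∈ Letter.x :: Letter.y :: Letter.t :: Letter.x :: A := by simp [h3]
    simp [hA] at this
  · have : List.count (Letter.z_ i) (Letter.x :: Letter.y :: Letter.t :: Letter.x :: A) = 0 :=
      List.count_eq_zero.2 (by simp [hA])
    simp [this]
  · rintro ⟨p, s, hp, h3⟩
    rcases p with _ | ⟨a, p⟩
    · simp only [List.nil_append, List.cons.injEq, true_and] at h3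
      rcases B with _ | ⟨b, B⟩
      · simp at h3
      · simp only [List.cons_append, List.cons.injEq] at h3
        exact hB (by simp [h3.1])
    · simp only [List.cons_append, List.cons.injEq] at h3
      exact hp (by simp [← h3.1])

theorem not_t_c_z (h : IsCBlock n R T) {i : ℕ} (h1 : 1 ≤ i) (h2 : i ≤ n)
    {c : Letter} (hc : c ≠ Letter.z_ i) :
    ¬ [Letter.t_ i, c, Letter.z_ i] <+ cList R T := by
  obtain ⟨A, B, C, h3, hA, hB, hC, hA', hB', hC'⟩ := h.exists_splitZT h1 h2
  intro h4
  rw [h3] at h4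
  have h5 := List.cons_sublist_cons.1
    (((h4.of_cons_append hA').of_cons_ne (by simp)).of_cons_append hB')
  exact hC (List.singleton_sublist.1 (h5.of_cons_ne hc).tail_of_cons)

theorem not_z_c_z_t (h : IsCBlock n R T) {i : ℕ} (h1 : 1 ≤ i) (h2 : i ≤ n) {c : Letter} :
    ¬ [Letter.z_ i, c, Letter.z_ i, Letter.t_ i] <+ cList R T := by
  obtain ⟨A, B, C, h3, hA, hB, hC, hA', hB', hC'⟩ := h.exists_splitZT h1 h2
  intro h4
  rw [h3] at h4
  have h5 := (List.cons_sublist_cons.1 (h4.of_cons_append hA)).tail_of_cons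
  have h6 := List.cons_sublist_cons.1 ((h5.of_cons_append hB).of_cons_ne (by simp))
  exact hC' (List.singleton_sublist.1 h6)

theorem not_y_c_y_ (h : IsCBlock n R T) {k : ℕ} (h1 : 1 ≤ k) (h2 : k < n)
    {c : Letter} (hc : c ≠ Letter.y_ k) :
    ¬ [Letter.y_ k, c, Letter.y_ k] <+ cList R T := by
  obtain ⟨A, B, h3, hA, hB⟩ := h.exists_splitY h1 h2
  intro h4
  rw [h3] at h4
  have h5 := List.cons_sublist_cons.1 (h4.of_cons_append hA)
  exact hB (List.singleton_sublist.1 (h5.of_cons_ne hc).tail_of_cons)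

theorem not_y_c_y_x (h : IsCBlock n R T) {c : Letter} :
    ¬ [Letter.y, c, Letter.y, Letter.x] <+ cList R T := by
  intro h1
  have h2 := (List.cons_sublist_cons.1 (h1.of_cons_ne (by simp))).tail_of_cons
  have h3 := ((h2.of_cons_ne (by simp)).of_cons_ne (by simp)).tail_of_cons
  exact h.x_notMem (List.singleton_sublist.1 h3)

theorem eq_of_x_c_x (h : IsCBlock n R T) {c : Letter}
    (h1 : [Letter.x, c, Letter.x] <+ cList R T) : c = Letter.y ∨ c = Letter.t := by
  have h2 := List.cons_sublist_cons.1 h1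
  rw [List.cons_sublist_cons', List.cons_sublist_cons', List.cons_sublist_cons'] at h2
  rcases h2 with ((h2 | h2) | h2) | h2
  · exact absurd (List.singleton_sublist.1 h2.tail_of_cons) h.x_notMem
  · exact absurd (List.singleton_sublist.1 h2.2) h.x_notMem
  · exact Or.inr h2.1
  · exact Or.inl h2.1

theorem not_t_y_x (h : IsCBlock n R T) : ¬ [Letter.t, Letter.y, Letter.x] <+ cList R T := by
  intro h1
  have h2 := List.cons_sublist_cons.1 ((h1.of_cons_ne (by simp)).of_cons_ne (by simp))
  exact h.x_notMem (List.singleton_sublist.1 (h2.of_cons_ne (by simp)).tail_of_cons)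

theorem not_t_y_c_y (h : IsCBlock n R T) {c : Letter} :
    ¬ [Letter.t, Letter.y, c, Letter.y] <+ cList R T := by
  intro h1
  have h2 := List.cons_sublist_cons.1 ((h1.of_cons_ne (by simp)).of_cons_ne (by simp))
  have h3 := List.cons_sublist_cons.1
    ((h2.of_cons_ne (by simp)).of_cons_append h.y_notMem_left)
  exact h.y_notMem_right (List.singleton_sublist.1 h3.tail_of_cons)

theorem not_x_of_ne (h : IsCBlock n R T) {a : Letter} (hx : a ≠ Letter.x) (hy : a ≠ Letter.y)
    (ht : a ≠ Letter.t) : ¬ [a, Letter.x] <+ cList R T := by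
  intro h1
  have h2 := (((h1.of_cons_ne hx).of_cons_ne hy).of_cons_ne ht).of_cons_ne hx
  exact h.x_notMem (List.singleton_sublist.1 h2.tail_of_cons)

theorem not_t_of_ne (h : IsCBlock n R T) {a : Letter} (hx : a ≠ Letter.x) (hy : a ≠ Letter.y)
    (ht : a ≠ Letter.t) : ¬ [a, Letter.t] <+ cList R T := by
  intro h1
  have h2 := (((h1.of_cons_ne hx).of_cons_ne hy).of_cons_ne ht).of_cons_ne hx
  exact h.t_notMem (List.singleton_sublist.1 h2.tail_of_cons)

theorem not_y_x_t (h : IsCBlock n R T) : ¬ [Letter.y, Letter.x, Letter.t] <+ cList R T := by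
  intro h1
  have h2 := List.cons_sublist_cons.1 (h1.of_cons_ne (by simp))
  have h3 := List.cons_sublist_cons.1 (h2.of_cons_ne (by simp))
  exact h.t_notMem (List.singleton_sublist.1 h3)

theorem not_y_c_y_c_y (h : IsCBlock n R T) {c d : Letter} :
    ¬ [Letter.y, c, Letter.y, d, Letter.y] <+ cList R T := by
  intro h1
  have h2 := (List.cons_sublist_cons.1 (h1.of_cons_ne (by simp))).tail_of_cons
  have h3 := List.cons_sublist_cons.1
    (((h2.of_cons_ne (by simp)).of_cons_ne (by simp)).of_cons_append h.y_notMem_left)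
  exact h.y_notMem_right (List.singleton_sublist.1 h3.tail_of_cons)

theorem not_y_x_y_y_ (h : IsCBlock n R T) {k : ℕ} :
    ¬ [Letter.y, Letter.x, Letter.y, Letter.y_ k] <+ cList R T := by
  intro h1
  have h2 := (List.cons_sublist_cons.1 (h1.of_cons_ne (by simp))).tail_of_cons
  have h3 := List.cons_sublist_cons.1
    (((h2.of_cons_ne (by simp)).of_cons_ne (by simp)).of_cons_append h.y_notMem_left)
  exact h.yIdx_notMem_right k (List.singleton_sublist.1 h3)

theorem not_t_y (h : IsCBlock n R T) (i : ℕ) :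
    ¬ [Letter.t_ i, Letter.y] <+ cList R T := by
  intro h1
  have h2 := ((((h1.of_cons_ne (by simp)).of_cons_ne (by simp)).of_cons_ne
    (by simp)).of_cons_ne (by simp)).of_cons_append (h.tIdx_notMem_left i)
  exact h.y_notMem_right (List.singleton_sublist.1 (h2.of_cons_ne (by simp)).tail_of_cons)

end IsCBlock

end

section

open scoped List

/-! ### Interchanging two factors of a word in the class of `c_{0,0,n}[ρ]` -/

namespace IsCBlock

variable {n : ℕ} {R T : List Letter} {P M Q X B Y S : List Letter}

/-- The content of X and Y recurs in M and the letters of B are multiple, so only P, Q and S have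
room for a simple letter. -/
theorem mem_of_count_eq_one {s : Letter} (hM : ∀ c, c ∈ M ↔ c ∈ X ∨ c ∈ Y)
    (hB : ∀ c ∈ B, (P ++ (M ++ (Q ++ (X ++ (B ++ (Y ++ S)))))).count c ≠ 1)
    (hs : (P ++ (M ++ (Q ++ (X ++ (B ++ (Y ++ S)))))).count s = 1) :
    s ∉ X ∧ s ∉ Y ∧ (s ∈ P ∨ s ∈ Q ∨ s ∈ S) := by
  have h1 : s ∈ P ++ (M ++ (Q ++ (X ++ (B ++ (Y ++ S))))) :=
    List.count_pos_iff.1 (by omega)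
  have hB' : s ∉ B := fun h => hB s h hs
  have hX : s ∉ X := fun h => by
    have h2 := List.count_pos_iff.2 h
    have h3 := List.count_pos_iff.2 ((hM s).2 (Or.inl h))
    simp only [List.count_append] at hs
    omega
  have hY : s ∉ Y := fun h => by
    have h2 := List.count_pos_iff.2 h
    have h3 := List.count_pos_iff.2 ((hM s).2 (Or.inr h))
    simp only [List.count_append] at hs
    omega
  simp only [List.mem_append, hM, hX, hY, hB', false_or] at h1
  exact ⟨hX, hY, h1⟩

/-- Choosing one letter in each of M, X, Y yields the scattered subwords dcd and ccd. For every pair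
other than (x, y) either c avoids one of these patterns (with a separator put into cc), or some
simple letter has no admissible place. -/
theorem eq_x_and_eq_y (h : IsCBlock n R T)
    (hL : ListLambda (P ++ (M ++ (Q ++ (X ++ (B ++ (Y ++ S)))))) (cList R T))
    (hM : ∀ c, c ∈ M ↔ c ∈ X ∨ c ∈ Y)
    (hB : ∀ c ∈ B, (P ++ (M ++ (Q ++ (X ++ (B ++ (Y ++ S)))))).count c ≠ 1)
    {c d : Letter} (hc : c ∈ X) (hd : d ∈ Y) (hcd : c ≠ d) : c = Letter.x ∧ d = Letter.y := by
  have hcM := (hM c).2 (Or.inl hc)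
  have hdM := (hM d).2 (Or.inr hd)
  have simple : ∀ s, (cList R T).count s = 1 → s ∉ X ∧ s ∉ Y ∧ (s ∈ P ∨ s ∈ Q ∨ s ∈ S) :=
    fun s hs => mem_of_count_eq_one hM hB (hL.count_eq_one hs)
  have dcd : [d, c, d] <+ P ++ (M ++ (Q ++ (X ++ (B ++ (Y ++ S))))) :=
    List.sublist_append_skip _ (List.cons_sublist_append_of_mem hdM (List.sublist_append_skip _
      (List.cons_sublist_append_of_mem hc (List.sublist_append_skip _
        (List.cons_sublist_append_of_mem hd (List.nil_sublist _))))))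
  have ccd : [c, c, d] <+ P ++ (M ++ (Q ++ (X ++ (B ++ (Y ++ S))))) :=
    List.sublist_append_skip _ (List.cons_sublist_append_of_mem hcM (List.sublist_append_skip _
      (List.cons_sublist_append_of_mem hc (List.sublist_append_skip _
        (List.cons_sublist_append_of_mem hd (List.nil_sublist _))))))
  have dcd' : [d, c, d] <+ cList R T := hL.sublist (by simp [hcd, hcd.symm]) dcd
  have hcD : c ∈ cList R T := dcd'.subset (by simp)
  have hdD : d ∈ cList R T := dcd'.subset (by simp)
  have ccd' : ¬ FirstTwoAdjacent c (cList R T) →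
      ∃ a, a ≠ c ∧ [c, a, c, d] <+ cList R T := by
    intro h1
    obtain ⟨a, ha, h2⟩ := exists_sublist_of_not_firstTwoAdjacent
      (hL.not_firstTwoAdjacent h1) ccd
    exact ⟨a, ha, hL.sublist (by simp [ha, ha.symm, hcd]) h2⟩
  rcases h.mem_cList hdD with rfl | rfl | rfl | ⟨i, h1, h2, rfl | rfl⟩ | ⟨k, h1, h2, rfl⟩
  · rcases h.eq_of_x_c_x dcd' with rfl | rfl
    · obtain ⟨a, ha, h3⟩ := ccd' not_firstTwoAdjacent_y
      exact absurd h3 h.not_y_c_y_x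
    · exact absurd hc (simple _ h.count_t).1
  · rcases h.mem_cList hcD with rfl | rfl | rfl | ⟨i, h1, h2, rfl | rfl⟩ | ⟨k, h1, h2, rfl⟩
    · exact ⟨rfl, rfl⟩
    · exact absurd rfl hcd
    · exact absurd hc (simple _ h.count_t).1
    · obtain ⟨a, ha, h3⟩ := ccd' (h.not_firstTwoAdjacent_z h1 h2)
      exact absurd h3 (h.not_z_c_z_y h1 h2)
    · exact absurd hc (simple _ (h.count_t_ h1 h2)).1
    -- The first two occurrences of `y_k` are adjacent in c, so `ccd'` is of no use. The letter t
    -- decides: in P it is followed by y `y_k` y, further right it is preceded by `y_k`.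
    · exfalso
      rcases (simple _ h.count_t).2.2 with ht | ht | ht
      · refine h.not_t_y_c_y (hL.sublist (by simp) (p := [_, _, Letter.y_ k, _]) ?_)
        exact List.cons_sublist_append_of_mem ht (List.cons_sublist_append_of_mem hdM
          (List.sublist_append_skip _ (List.cons_sublist_append_of_mem hc
            (List.sublist_append_skip _
              (List.cons_sublist_append_of_mem hd (List.nil_sublist _))))))
      · refine h.not_t_of_ne (a := Letter.y_ k) (by simp) (by simp) (by simp)
          (hL.sublist (by simp) ?_)
        exact List.sublist_append_skip _ (List.cons_sublist_append_of_mem hcM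
          (List.cons_sublist_append_of_mem ht (List.nil_sublist _)))
      · refine h.not_t_of_ne (a := Letter.y_ k) (by simp) (by simp) (by simp)
          (hL.sublist (by simp) ?_)
        exact List.sublist_append_skip _ (List.cons_sublist_append_of_mem hcM
          (List.singleton_sublist.2 (by simp [ht])))
  · exact absurd hd (simple _ h.count_t).2.1
  -- The simple letter `t_i` either precedes c and the last `z_i` (in P or Q), or follows `z_i` c
  -- `z_i` (in S).
  · exfalso
    rcases (simple _ (h.count_t_ h1 h2)).2.2 with ht | ht | ht
    · refine h.not_t_c_z h1 h2 hcd (hL.sublist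
        (by simp [hcd, (ne_of_mem_of_not_mem hc (simple _ (h.count_t_ h1 h2)).1).symm]) ?_)
      exact List.cons_sublist_append_of_mem ht (List.sublist_append_skip _
        (List.sublist_append_skip _ (List.cons_sublist_append_of_mem hc
          (List.sublist_append_skip _ (List.cons_sublist_append_of_mem hd
            (List.nil_sublist _))))))
    · refine h.not_t_c_z h1 h2 hcd (hL.sublist
        (by simp [hcd, (ne_of_mem_of_not_mem hc (simple _ (h.count_t_ h1 h2)).1).symm]) ?_)
      exact List.sublist_append_skip _ (List.sublist_append_skip _
        (List.cons_sublist_append_of_mem ht (List.cons_sublist_append_of_mem hc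
          (List.sublist_append_skip _ (List.cons_sublist_append_of_mem hd
            (List.nil_sublist _))))))
    · refine h.not_z_c_z_t h1 h2 (hL.sublist (by simp [hcd, hcd.symm]) (p := [_, c, _, _]) ?_)
      exact List.sublist_append_skip _ (List.cons_sublist_append_of_mem hdM
        (List.sublist_append_skip _ (List.cons_sublist_append_of_mem hc
          (List.sublist_append_skip _ (List.cons_sublist_append_of_mem hd
            (List.singleton_sublist.2 ht))))))
  · exact absurd hd (simple _ (h.count_t_ h1 h2)).2.1
  · exact absurd dcd' (h.not_y_c_y_ h1 h2 hcd)

theorem append_comm_or_mem (h : IsCBlock n R T)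
    (hL : ListLambda (P ++ ((X ++ Y) ++ (Q ++ (X ++ (B ++ (Y ++ S)))))) (cList R T))
    (hB : ∀ c ∈ B, (P ++ ((X ++ Y) ++ (Q ++ (X ++ (B ++ (Y ++ S)))))).count c ≠ 1) :
    X ++ Y = Y ++ X ∨ (Letter.x ∈ X ∧ Letter.y ∈ Y) := by
  by_contra! hne
  refine hne.1 (List.append_comm_of_forall_eq fun c hc d hd => ?_)
  by_contra hcd
  obtain ⟨rfl, rfl⟩ := h.eq_x_and_eq_y hL (by simp) hB hc hd hcd
  exact hne.2 hc hd

/-- In the reversed order even the exceptional pair is impossible: the subword yx of YX leaves no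
place for t, since c contains neither tyx nor yxt. -/
theorem append_comm_of_swapped (h : IsCBlock n R T)
    (hL : ListLambda (P ++ ((Y ++ X) ++ (Q ++ (X ++ (B ++ (Y ++ S)))))) (cList R T))
    (hB : ∀ c ∈ B, (P ++ ((Y ++ X) ++ (Q ++ (X ++ (B ++ (Y ++ S)))))).count c ≠ 1) :
    X ++ Y = Y ++ X := by
  have hM : ∀ c, c ∈ Y ++ X ↔ c ∈ X ∨ c ∈ Y := fun c => by simp [or_comm]
  refine List.append_comm_of_forall_eq fun c hc d hd => ?_
  by_contra hcd
  obtain ⟨rfl, rfl⟩ := h.eq_x_and_eq_y hL hM hB hc hd hcd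
  have hyx : ∀ A, [Letter.y, Letter.x] ++ A <+ (Y ++ X) ++ A := fun A =>
    List.Sublist.append (List.cons_sublist_append_of_mem hd (List.singleton_sublist.2 hc))
      (List.Sublist.refl _)
  rcases (mem_of_count_eq_one hM hB (hL.count_eq_one h.count_t)).2.2 with ht | ht
  · refine h.not_t_y_x (hL.sublist (by simp) ?_)
    exact List.cons_sublist_append_of_mem ht
      ((hyx []).trans ((List.Sublist.refl _).append (List.nil_sublist _)))
  · refine h.not_y_x_t (hL.sublist (by simp) ?_)
    refine List.sublist_append_skip _ (List.Sublist.trans ?_ (hyx _))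
    exact List.Sublist.append (List.Sublist.refl [Letter.y, Letter.x])
      (List.singleton_sublist.2 (by simp; tauto))

end IsCBlock

end

section

open scoped List

/-! ### The words of the non-modular sublattice -/

/-- An alphabet that consists of two copies of the original one and of five further letters. -/
inductive DLetter : Type
  | a (c : Letter) : DLetter
  | b (c : Letter) : DLetter
  | u : DLetter
  | v : DLetter
  | w : DLetter
  | p : DLetter
  | q : DLetter
  deriving DecidableEq

/-- The word
`u X₁ t v p x X₂ v R y T s x' w u R' y' q w T'`, where `x', y', s, R', T'` are letters and words
over the second copy of the alphabet. -/
def doubleWord (R T : List Letter) (X₁ X₂ : List DLetter) : List DLetter :=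
  DLetter.u :: (X₁ ++ (DLetter.a .t :: DLetter.v :: DLetter.p :: DLetter.a .x :: (X₂ ++
    (DLetter.v :: (R.map DLetter.a ++
    (DLetter.a .y :: (T.map DLetter.a ++
      (DLetter.b .t :: DLetter.b .x :: DLetter.w :: DLetter.u :: (R.map DLetter.b ++
      (DLetter.b .y :: DLetter.q :: DLetter.w :: T.map DLetter.b))))))))))

/-- The word `doubleWord R T (xy) (x'y')`. -/
def baseWord (R T : List Letter) : List DLetter :=
  doubleWord R T [DLetter.a .x, DLetter.a .y] [DLetter.b .x, DLetter.b .y]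

/-- A test for words over `DLetter`: a word passes the test if its image, multiplied by `pre`,
belongs to the `λ`-class of a given word. -/
structure WordTest where
  pre : List Letter
  map : DLetter → List Letter

namespace WordTest

def Passes (D : List Letter) (τ : WordTest) (l : List DLetter) : Prop :=
  ListLambda (τ.pre ++ l.flatMap τ.map) D

/-- Each image that contains `x` (or each image that contains `y`) also contains a letter that is
simple in the word `c_{0,0,n}[ρ]`. -/
def Noncritical (τ : WordTest) : Prop :=
  (∀ g, Letter.x ∈ τ.map g → Letter.t ∈ τ.map g) ∨
    ∀ g, Letter.y ∈ τ.map g → Letter.t ∈ τ.map g ∨ Letter.t_ 1 ∈ τ.map g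

/-- The projection to the first copy of the alphabet. -/
def projA : WordTest where
  pre := []
  map
    | .a c => [c]
    | _ => []

/-- The projection to the second copy of the alphabet. -/
def projB : WordTest where
  pre := []
  map
    | .b c => [c]
    | _ => []

end WordTest

/-- The word `l` passes all noncritical tests that the base word passes. -/
def Guarded (R T : List Letter) (l : List DLetter) : Prop :=
  ∀ τ : WordTest, τ.Noncritical → τ.Passes (cList R T) (baseWord R T) → τ.Passes (cList R T) l

namespace WordTest

theorem Passes.sublist {D : List Letter} {τ : WordTest} {l : List DLetter} (h : τ.Passes D l)
    {p : List DLetter} {p' : List Letter} (hp : p <+ l) (hp' : p' = p.flatMap τ.map)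
    (hc : p'.IsChain (· ≠ ·)) : p' <+ D := by
  subst hp'
  exact ListLambda.sublist h hc (List.sublist_append_skip _ (hp.flatMap _))

end WordTest

theorem List.flatMap_eq_self {α : Type*} {f : α → List α} {l : List α}
    (h : ∀ c ∈ l, f c = [c]) : l.flatMap f = l := by
  induction l with
  | nil => rfl
  | cons a l ih =>
    rw [List.flatMap_cons, h a (by simp), ih fun c hc => h c (by simp [hc])]
    rfl

theorem ListLambda.refl (D : List Letter) : ListLambda D D := lambdaCon.refl _

/-! ### Factorisations of c from which tests are built, and images of the blocks R and T -/

namespace IsCBlock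

variable {n : ℕ} {R T : List Letter}

/-- The two occurrences of the first letter of R cut c into pieces that can serve as images of
letters. The piece M contains y, but also the simple letter `t_1`, so using it keeps a test
noncritical. -/
theorem exists_cList_eq_head (h : IsCBlock n R T) : ∃ f M S, 1 ≤ f ∧ f ≤ n ∧
    cList R T = Letter.x :: Letter.y :: Letter.t :: Letter.x :: Letter.z_ f ::
      (M ++ Letter.z_ f :: S) ∧ Letter.t_ 1 ∈ M ∧ Letter.y ∉ S ∧ Letter.x ∉ M ∧ Letter.x ∉ S := by
  obtain ⟨f, R', h1, h2, hR⟩ := h.headR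
  obtain ⟨T', hT'⟩ := h.headT
  obtain ⟨A, B, hT, -⟩ := h.splitT f h1 h2
  have hx := h.x_notMem
  have hy := h.y_notMem_right
  refine ⟨f, R' ++ Letter.y :: (A ++ [Letter.t_ f]), B, h1, h2, ?_, ?_, ?_, ?_, ?_⟩
  · simp [cList, hR, hT]
  · cases A with
    | nil =>
      rw [hT'] at hT
      simp only [List.nil_append, List.cons.injEq] at hT
      simp [hT.1]
    | cons c A =>
      rw [hT'] at hT
      simp only [List.cons_append, List.cons.injEq] at hT
      simp [hT.1]
  all_goals
    rw [hT] at hx hy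
    rw [hR] at hx
    simp at hx hy
    simp [hx, hy]

/-- Here the cut is made at the letter in front of the second y. The second x shares the piece `t x
R'` with the simple letter t, and the first one can be supplied by `pre`. -/
theorem exists_cList_eq_last (h : IsCBlock n R T) : ∃ l R' M S, 1 ≤ l ∧ l ≤ n ∧
    cList R T = Letter.x :: Letter.y :: ((Letter.t :: Letter.x :: R') ++ Letter.z_ l ::
      Letter.y :: (M ++ Letter.z_ l :: S)) ∧ Letter.t_ 1 ∈ M ∧
    (Letter.x ∉ M ∧ Letter.y ∉ M ∧ Letter.z_ l ∉ M) ∧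
    (Letter.x ∉ S ∧ Letter.y ∉ S ∧ Letter.z_ l ∉ S) ∧
    Letter.y ∉ R' ∧ Letter.z_ l ∉ R' := by
  obtain ⟨l, R', h1, h2, hR⟩ := h.lastR
  obtain ⟨T', hT'⟩ := h.headT
  obtain ⟨A, B, hT, hA, hB, -⟩ := h.splitT l h1 h2
  obtain ⟨A', B', hR', hA', hB'⟩ := h.splitZ l h1 h2
  have hz : Letter.z_ l ∉ R' := by
    have h3 : (R' ++ [Letter.z_ l]).count (Letter.z_ l) = (A' ++
      Letter.z_ l :: B').count (Letter.z_ l) := by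
      rw [← hR, ← hR']
    simp only [List.count_append, List.count_cons_self, List.count_eq_zero.2 hA',
      List.count_eq_zero.2 hB', List.count_nil] at h3
    exact List.count_eq_zero.1 (by omega)
  have hx := h.x_notMem
  have hy := h.y_notMem_right
  have hy' := h.y_notMem_left
  rw [hT] at hx hy
  rw [hR] at hx hy'
  simp at hx hy hy'
  refine ⟨l, R', A ++ [Letter.t_ l], B, h1, h2, ?_, ?_, ?_, ?_, ?_, ?_⟩
  · simp [cList, hR, hT]
  · cases A with
    | nil =>
      rw [hT'] at hT
      simp only [List.nil_append, List.cons.injEq] at hT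
      simp [hT.1]
    | cons c A =>
      rw [hT'] at hT
      simp only [List.cons_append, List.cons.injEq] at hT
      simp [hT.1]
  · simp [hx, hy, hA]
  · simp [hx, hy, hB]
  · simp [hy']
  · exact hz

theorem exists_headT (h : IsCBlock n R T) (hn : 1 ≤ n) : ∃ T', T = Letter.t_ 1 :: T' ∧
    Letter.t_ 1 ∉ T' := by
  obtain ⟨T', hT'⟩ := h.headT
  obtain ⟨A, B, hT, -, -, hA, hB⟩ := h.splitT 1 le_rfl hn
  refine ⟨T', hT', ?_⟩
  cases A with
  | nil =>
    rw [hT'] at hT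
    simp only [List.nil_append, List.cons.injEq, true_and] at hT
    simp [hT, hB]
  | cons c A =>
    rw [hT'] at hT
    simp only [List.cons_append, List.cons.injEq] at hT
    simp [hT.1] at hA

theorem flatMap_left (h : IsCBlock n R T) {f : Letter → List Letter}
    (hz : ∀ i, f (Letter.z_ i) = []) (hy : ∀ i, f (Letter.y_ i) = []) : R.flatMap f = [] := by
  rw [List.flatMap_eq_nil_iff]
  intro c hc
  rcases h.memR c hc with ⟨i, -, -, rfl⟩ | ⟨i, -, -, rfl⟩
  · exact hz i
  · exact hy i

theorem flatMap_right (h : IsCBlock n R T) {f : Letter → List Letter}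
    (hz : ∀ i, f (Letter.z_ i) = []) (hy : ∀ i, f (Letter.t_ i) = []) : T.flatMap f = [] := by
  rw [List.flatMap_eq_nil_iff]
  intro c hc
  rcases h.memT c hc with ⟨i, -, -, rfl | rfl⟩
  · exact hy i
  · exact hz i

theorem flatMap_left_eq_self (h : IsCBlock n R T) {f : Letter → List Letter}
    (hz : ∀ i, f (Letter.z_ i) = [Letter.z_ i]) (hy : ∀ i, f (Letter.y_ i) = [Letter.y_ i]) :
    R.flatMap f = R := by
  refine List.flatMap_eq_self fun c hc => ?_
  rcases h.memR c hc with ⟨i, -, -, rfl⟩ | ⟨i, -, -, rfl⟩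
  · exact hz i
  · exact hy i

theorem flatMap_right_eq (h : IsCBlock n R T) (hn : 1 ≤ n) {f : Letter → List Letter}
    {l : List Letter} (h1 : f (Letter.t_ 1) = l ++ [Letter.t_ 1])
    (ht : ∀ i, i ≠ 1 → f (Letter.t_ i) = [Letter.t_ i]) (hz : ∀ i, f (Letter.z_ i)
      = [Letter.z_ i]) :
    T.flatMap f = l ++ T := by
  obtain ⟨T', hT, hT'⟩ := h.exists_headT hn
  have : T'.flatMap f = T' := by
    refine List.flatMap_eq_self fun c hc => ?_
    rcases h.memT c (by simp [hT, hc]) with ⟨i, -, -, rfl | rfl⟩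
    · exact ht i fun hi => hT' (hi ▸ hc)
    · exact hz i
  rw [hT, List.flatMap_cons, this, h1]
  simp

theorem flatMap_right_eq_of_t (h : IsCBlock n R T) (hn : 1 ≤ n) {f : Letter → List Letter}
    {l : List Letter} (h1 : f (Letter.t_ 1) = l)
    (ht : ∀ i, i ≠ 1 → f (Letter.t_ i) = []) (hz : ∀ i, f (Letter.z_ i) = []) :
    T.flatMap f = l := by
  obtain ⟨T', hT, hT'⟩ := h.exists_headT hn
  have : T'.flatMap f = [] := by
    rw [List.flatMap_eq_nil_iff]
    intro c hc
    rcases h.memT c (by simp [hT, hc]) with ⟨i, -, -, rfl | rfl⟩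
    · exact ht i fun hi => hT' (hi ▸ hc)
    · exact hz i
  rw [hT, List.flatMap_cons, this, h1]
  simp

end IsCBlock

theorem flatMap_const_nil (l : List Letter) : (l.flatMap fun _ => ([] : List Letter)) = [] := by
  simp

theorem projA_passes (R T : List Letter) :
    WordTest.projA.Passes (cList R T) (baseWord R T) := by
  have : WordTest.projA.pre ++ (baseWord R T).flatMap WordTest.projA.map = cList R T := by
    simp [WordTest.projA, baseWord, doubleWord, List.flatMap_map, cList, flatMap_const_nil]
  rw [WordTest.Passes, this]
  exact ListLambda.refl _

theorem projB_passes (R T : List Letter) :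
    WordTest.projB.Passes (cList R T) (baseWord R T) := by
  have : WordTest.projB.pre ++ (baseWord R T).flatMap WordTest.projB.map = cList R T := by
    simp [WordTest.projB, baseWord, doubleWord, List.flatMap_map, cList, flatMap_const_nil]
  rw [WordTest.Passes, this]
  exact ListLambda.refl _

end

section

open scoped List

/-! ### Consequences of the tests -/

namespace Guarded

variable {n : ℕ} {R T : List Letter} {l : List DLetter}

theorem passes_of_eq (hl : Guarded R T l) (τ : WordTest) (h1 : τ.Noncritical)
    (h2 : τ.pre ++ (baseWord R T).flatMap τ.map = cList R T) : τ.Passes (cList R T) l :=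
  hl τ h1 (by rw [WordTest.Passes, h2]; exact ListLambda.refl _)

/-- This and the following facts each come from one noncritical test that sends the base word
exactly to c. Here y occurs only in images together with t or `t_1`, and `b e` becomes `z_f`, which
precedes neither x nor t in c. -/
theorem facts_of_head (h : IsCBlock n R T) (hl : Guarded R T l) {e : Letter}
    (he : e = Letter.x ∨ e = Letter.y) :
    DLetter.a .t ∈ l ∧ ¬ [DLetter.b e, DLetter.a .x] <+ l ∧ ¬ [DLetter.b e, DLetter.a .t] <+ l := by
  obtain ⟨f, M, S, h1, h2, hD, hM, hS, hM', hS'⟩ := h.exists_cList_eq_head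
  let τ : WordTest := ⟨[], fun
    | .a .x => [.x]
    | .a .t => [.y, .t]
    | .b c => if c = e then [Letter.z_ f] else if c = .t then M else []
    | .q => S
    | _ => []⟩
  have hR : (R.map DLetter.a).flatMap τ.map = [] := by
    rw [List.flatMap_map]
    exact h.flatMap_left (fun _ => rfl) fun _ => rfl
  have hR' : (R.map DLetter.b).flatMap τ.map = [] := by
    rw [List.flatMap_map]
    refine h.flatMap_left (fun _ => ?_) fun _ => ?_ <;> rcases he with rfl | rfl <;> simp [τ]
  have hT : (T.map DLetter.a).flatMap τ.map = [] := by
    rw [List.flatMap_map]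
    exact h.flatMap_right (fun _ => rfl) fun _ => rfl
  have hT' : (T.map DLetter.b).flatMap τ.map = [] := by
    rw [List.flatMap_map]
    refine h.flatMap_right (fun _ => ?_) fun _ => ?_ <;> rcases he with rfl | rfl <;> simp [τ]
  have hp : τ.Passes (cList R T) l := by
    refine hl.passes_of_eq τ (Or.inr fun g hg => ?_) ?_
    · rcases g with c | c | _ | _ | _ | _ | _
      · rcases c with _ | _ | _ | _ | _ | _ <;> simp [τ] at hg ⊢
      · simp only [τ] at hg ⊢
        split_ifs at hg ⊢ <;> simp_all
      all_goals simp [τ] at hg ⊢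
      exact (hS hg).elim
    · rw [hD]
      simp only [baseWord, doubleWord, List.flatMap_cons, List.flatMap_append, hR, hR', hT, hT']
      rcases he with rfl | rfl <;> simp [τ]
  refine ⟨?_, fun h3 => ?_, fun h3 => ?_⟩
  · have ht : Letter.t ∈ τ.pre ++ l.flatMap τ.map := by
      rw [hp.mem_iff, hD]; simp
    obtain ⟨g, hg, hg'⟩ := List.mem_flatMap.1 (show Letter.t ∈ l.flatMap τ.map by simpa [τ] using
      ht)
    have htM : Letter.t ∉ M ∧ Letter.t ∉ S := by
      have := h.count_t
      rw [hD] at this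
      simp at this
      simpa [List.count_eq_zero] using this
    rcases g with c | c | _ | _ | _ | _ | _
    · rcases c with _ | _ | _ | _ | _ | _ <;> simp [τ] at hg'
      exact hg
    · simp only [τ] at hg'
      split_ifs at hg' <;> simp_all
    all_goals simp [τ, htM] at hg'
  · exact h.not_x_of_ne (a := Letter.z_ f) (by simp) (by simp) (by simp)
      (hp.sublist h3 (by simp [τ]) (by simp))
  · refine h.not_t_of_ne (a := Letter.z_ f) (by simp) (by simp) (by simp)
      (List.Sublist.trans ?_ (hp.sublist (p' := [Letter.z_ f, .y, .t]) h3 (by simp [τ]) (by simp)))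
    exact List.Sublist.cons_cons _ (List.sublist_cons_self _ _)

/-- The whole prefix xytx is the image of `a .t`, and `v` becomes `z_f`, which cannot precede t. -/
theorem not_v_t (h : IsCBlock n R T) (hl : Guarded R T l) :
    ¬ [DLetter.v, DLetter.a .t] <+ l := by
  obtain ⟨f, M, S, h1, h2, hD, hM, hS, hM', hS'⟩ := h.exists_cList_eq_head
  let τ : WordTest := ⟨[], fun
    | .a .t => [.x, .y, .t, .x]
    | .v => [Letter.z_ f]
    | .p => M
    | .b .t => S
    | _ => []⟩
  have hR : (R.map DLetter.a).flatMap τ.map = [] := by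
    rw [List.flatMap_map]
    exact h.flatMap_left (fun _ => rfl) fun _ => rfl
  have hR' : (R.map DLetter.b).flatMap τ.map = [] := by
    rw [List.flatMap_map]
    exact h.flatMap_left (fun _ => rfl) fun _ => rfl
  have hT : (T.map DLetter.a).flatMap τ.map = [] := by
    rw [List.flatMap_map]
    exact h.flatMap_right (fun _ => rfl) fun _ => rfl
  have hT' : (T.map DLetter.b).flatMap τ.map = [] := by
    rw [List.flatMap_map]
    exact h.flatMap_right (fun _ => rfl) fun _ => rfl
  have hp : τ.Passes (cList R T) l := by
    refine hl.passes_of_eq τ (Or.inl fun g hg => ?_) ?_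
    · rcases g with c | c | _ | _ | _ | _ | _
      · rcases c with _ | _ | _ | _ | _ | _ <;> simp [τ] at hg ⊢
      · rcases c with _ | _ | _ | _ | _ | _ <;> simp [τ, hS'] at hg ⊢
      all_goals simp [τ, hM'] at hg ⊢
    · rw [hD]
      simp only [baseWord, doubleWord, List.flatMap_cons, List.flatMap_append, hR, hR', hT, hT']
      simp [τ]
  intro h3
  refine h.not_t_of_ne (a := Letter.z_ f) (by simp) (by simp) (by simp)
    (List.Sublist.trans ?_
      (hp.sublist (p' := [Letter.z_ f, .x, .y, .t, .x]) h3 (by simp [τ]) (by simp)))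
  exact List.Sublist.cons_cons _ (List.cons_sublist_append_of_mem
    (A := [Letter.x, Letter.y, Letter.t]) (by simp) (List.nil_sublist _))

/-- The test lets `b .x` play x and `w` play `z_f`, while y is tied to t or `t_1`. -/
theorem not_w_x (h : IsCBlock n R T) (hn : 1 ≤ n) (hl : Guarded R T l) :
    ¬ [DLetter.w, DLetter.b .x] <+ l := by
  obtain ⟨f, M, S, h1, h2, hD, hM, hS, hM', hS'⟩ := h.exists_cList_eq_head
  let τ : WordTest := ⟨[], fun
    | .b .x => [.x]
    | .b .t => [.y, .t]
    | .w => [Letter.z_ f]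
    | .q => M
    | .b (.t_ 1) => S
    | _ => []⟩
  have hR : (R.map DLetter.a).flatMap τ.map = [] := by
    rw [List.flatMap_map]
    exact h.flatMap_left (fun _ => rfl) fun _ => rfl
  have hR' : (R.map DLetter.b).flatMap τ.map = [] := by
    rw [List.flatMap_map]
    exact h.flatMap_left (fun _ => rfl) fun _ => rfl
  have hT : (T.map DLetter.a).flatMap τ.map = [] := by
    rw [List.flatMap_map]
    exact h.flatMap_right (fun _ => rfl) fun _ => rfl
  have hT' : (T.map DLetter.b).flatMap τ.map = S := by
    rw [List.flatMap_map]
    exact h.flatMap_right_eq_of_t hn rfl (fun i hi => by simp [τ, hi]) fun _ => rfl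
  have hp : τ.Passes (cList R T) l := by
    refine hl.passes_of_eq τ (Or.inr fun g hg => ?_) ?_
    · rcases g with c | c | _ | _ | _ | _ | _
      · rcases c with _ | _ | _ | _ | _ | _ <;> simp [τ] at hg ⊢
      · rcases c with _ | _ | _ | _ | _ | i
        all_goals try simp [τ] at hg ⊢
        split at hg <;> simp_all
      all_goals simp [τ] at hg ⊢
      exact Or.inr hM
    · rw [hD]
      simp only [baseWord, doubleWord, List.flatMap_cons, List.flatMap_append, hR, hR', hT, hT']
      simp [τ]
  intro h3
  exact h.not_x_of_ne (a := Letter.z_ f) (by simp) (by simp) (by simp)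
    (hp.sublist h3 (by simp [τ]) (by simp))

/-- With the first x in `pre` and the second tied to t in the image of `p`, the letter `v` may
become a bare y. Only `b e` produces `z_k` and only `v` produces y, so the subword `z_k` y of c is
traced back to `b e`, `v`. The image of `b .t` contains `t_1`, which never precedes y. -/
theorem facts_of_last (h : IsCBlock n R T) (hl : Guarded R T l) {e : Letter}
    (he : e = Letter.x ∨ e = Letter.y) :
    [DLetter.b e, DLetter.v] <+ l ∧ ¬ [DLetter.b .t, DLetter.v] <+ l := by
  obtain ⟨k, R', M, S, h1, h2, hD, hM, ⟨hM1, hM2, hM3⟩, ⟨hS1, hS2, hS3⟩, hR1, hR2⟩ :=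
    h.exists_cList_eq_last
  let τ : WordTest := ⟨[.x], fun
    | .v => [.y]
    | .p => .t :: .x :: R'
    | .b c => if c = e then [Letter.z_ k] else if c = .t then M else []
    | .q => S
    | _ => []⟩
  have hR : (R.map DLetter.a).flatMap τ.map = [] := by
    rw [List.flatMap_map]
    exact h.flatMap_left (fun _ => rfl) fun _ => rfl
  have hR' : (R.map DLetter.b).flatMap τ.map = [] := by
    rw [List.flatMap_map]
    refine h.flatMap_left (fun _ => ?_) fun _ => ?_ <;> rcases he with rfl | rfl <;> simp [τ]
  have hT : (T.map DLetter.a).flatMap τ.map = [] := by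
    rw [List.flatMap_map]
    exact h.flatMap_right (fun _ => rfl) fun _ => rfl
  have hT' : (T.map DLetter.b).flatMap τ.map = [] := by
    rw [List.flatMap_map]
    refine h.flatMap_right (fun _ => ?_) fun _ => ?_ <;> rcases he with rfl | rfl <;> simp [τ]
  have hp : τ.Passes (cList R T) l := by
    refine hl.passes_of_eq τ (Or.inl fun g hg => ?_) ?_
    · rcases g with c | c | _ | _ | _ | _ | _
      · simp [τ] at hg
      · simp only [τ] at hg ⊢
        split_ifs at hg ⊢ <;> simp_all
      all_goals simp [τ, hS1] at hg ⊢
    · rw [hD]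
      simp only [baseWord, doubleWord, List.flatMap_cons, List.flatMap_append, hR, hR', hT, hT']
      rcases he with rfl | rfl <;> simp [τ]
  have hy : ∀ g, Letter.y ∈ τ.map g → g = DLetter.v := by
    intro g hg
    rcases g with c | c | _ | _ | _ | _ | _
    · simp [τ] at hg
    · simp only [τ] at hg
      split_ifs at hg <;> simp_all
    all_goals simp [τ, hS2, hR1] at hg ⊢
  have hz : ∀ g, Letter.z_ k ∈ τ.map g → g = DLetter.b e := by
    intro g hg
    rcases g with c | c | _ | _ | _ | _ | _
    · simp [τ] at hg
    · simp only [τ] at hg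
      split_ifs at hg <;> simp_all
    all_goals simp [τ, hS3, hR2] at hg ⊢
  refine ⟨?_, fun h3 => ?_⟩
  · have h3 : [Letter.z_ k, Letter.y] <+ τ.pre ++ l.flatMap τ.map :=
      ListLambda.sublist (ListLambda.symm hp) (by simp) (h.z_y_sublist h1 h2)
    rcases List.mem_flatMap_sublist_pair (h3.of_cons_append (by simp [τ])) with
      ⟨g, g', h4, h5, h6⟩ | ⟨g, -, h5⟩
    · rwa [hz g h4, hy g' h5] at h6
    · rw [hy g (h5.subset (by simp))] at h5
      simp [τ] at h5
  · refine h.not_t_y 1 (ListLambda.sublist hp (by simp) (List.sublist_append_skip _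
      (List.Sublist.trans ?_ (h3.flatMap τ.map))))
    have ht : τ.map (DLetter.b .t) = M := by rcases he with rfl | rfl <;> simp [τ]
    rw [List.flatMap_cons, ht]
    exact List.cons_sublist_append_of_mem hM (by simp [τ])

/-- As in `facts_of_last`, with `u` as y, `w` as `z_k`, and t, x tied together in the image of `a
.t`. The second claim holds because c avoids t y `z_k` y. -/
theorem facts_w_u (h : IsCBlock n R T) (hn : 1 ≤ n) (hl : Guarded R T l) :
    [DLetter.w, DLetter.u] <+ l ∧
      ¬ [DLetter.a .t, DLetter.u, DLetter.w, DLetter.u] <+ l := by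
  obtain ⟨k, R', M, S, h1, h2, hD, hM, ⟨hM1, hM2, hM3⟩, ⟨hS1, hS2, hS3⟩, hR1, hR2⟩ :=
    h.exists_cList_eq_last
  let τ : WordTest := ⟨[.x], fun
    | .u => [.y]
    | .a .t => .t :: .x :: R'
    | .w => [Letter.z_ k]
    | .q => M
    | .b (.t_ 1) => S
    | _ => []⟩
  have hR : (R.map DLetter.a).flatMap τ.map = [] := by
    rw [List.flatMap_map]
    exact h.flatMap_left (fun _ => rfl) fun _ => rfl
  have hR' : (R.map DLetter.b).flatMap τ.map = [] := by
    rw [List.flatMap_map]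
    exact h.flatMap_left (fun _ => rfl) fun _ => rfl
  have hT : (T.map DLetter.a).flatMap τ.map = [] := by
    rw [List.flatMap_map]
    exact h.flatMap_right (fun _ => rfl) fun _ => rfl
  have hT' : (T.map DLetter.b).flatMap τ.map = S := by
    rw [List.flatMap_map]
    exact h.flatMap_right_eq_of_t hn rfl (fun i hi => by simp [τ, hi]) fun _ => rfl
  have hb : ∀ c, τ.map (.b c) = [] ∨ τ.map (.b c) = S := by
    intro c
    rcases c with _ | _ | _ | _ | _ | i
    all_goals try exact Or.inl rfl
    by_cases hi : i = 1
    · subst hi; exact Or.inr rfl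
    · exact Or.inl (by simp [τ, hi])
  have hp : τ.Passes (cList R T) l := by
    refine hl.passes_of_eq τ (Or.inl fun g hg => ?_) ?_
    · rcases g with c | c | _ | _ | _ | _ | _
      · rcases c with _ | _ | _ | _ | _ | _ <;> simp [τ] at hg ⊢
      · rcases hb c with hc | hc <;> simp [hc, hS1] at hg
      all_goals simp [τ, hM1] at hg ⊢
    · rw [hD]
      simp only [baseWord, doubleWord, List.flatMap_cons, List.flatMap_append, hR, hR', hT, hT']
      simp [τ]
  have hy : ∀ g, Letter.y ∈ τ.map g → g = DLetter.u := by
    intro g hg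
    rcases g with c | c | _ | _ | _ | _ | _
    · rcases c with _ | _ | _ | _ | _ | _ <;> simp [τ, hR1] at hg ⊢
    · rcases hb c with hc | hc <;> simp [hc, hS2] at hg
    all_goals simp [τ, hM2] at hg ⊢
  have hz : ∀ g, Letter.z_ k ∈ τ.map g → g = DLetter.w := by
    intro g hg
    rcases g with c | c | _ | _ | _ | _ | _
    · rcases c with _ | _ | _ | _ | _ | _ <;> simp [τ, hR2] at hg ⊢
    · rcases hb c with hc | hc <;> simp [hc, hS3] at hg
    all_goals simp [τ, hM3] at hg ⊢
  refine ⟨?_, fun h3 => ?_⟩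
  · have h3 : [Letter.z_ k, Letter.y] <+ τ.pre ++ l.flatMap τ.map :=
      ListLambda.sublist (ListLambda.symm hp) (by simp) (h.z_y_sublist h1 h2)
    rcases List.mem_flatMap_sublist_pair (h3.of_cons_append (by simp [τ])) with
      ⟨g, g', h4, h5, h6⟩ | ⟨g, -, h5⟩
    · rwa [hz g h4, hy g' h5] at h6
    · rw [hy g (h5.subset (by simp))] at h5
      simp [τ] at h5
  · refine h.not_t_y_c_y (c := Letter.z_ k) (ListLambda.sublist hp (by simp)
      (List.sublist_append_skip _ (List.Sublist.trans ?_ (h3.flatMap τ.map))))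
    rw [List.flatMap_cons]
    exact List.cons_sublist_append_of_mem (by simp [τ]) (by simp [τ])

/-- The letter `v` plays x, the blocks R and T of the first copy are kept, and both occurrences of y
are moved into the images of `p` and `t_1`. No `z_i` or `y_i` precedes x in c. -/
theorem facts_a_v (h : IsCBlock n R T) (hn : 1 ≤ n) (hl : Guarded R T l) (i : ℕ) :
    ¬ [DLetter.a (.z_ i), DLetter.v] <+ l ∧ ¬ [DLetter.a (.y_ i), DLetter.v] <+ l := by
  let τ : WordTest := ⟨[], fun
    | .v => [.x]
    | .p => [.y, .t]
    | .a (.z_ i) => [.z_ i]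
    | .a (.y_ i) => [.y_ i]
    | .a (.t_ i) => if i = 1 then [.y, .t_ 1] else [.t_ i]
    | _ => []⟩
  have hR : (R.map DLetter.a).flatMap τ.map = R := by
    rw [List.flatMap_map]
    exact h.flatMap_left_eq_self (fun _ => rfl) fun _ => rfl
  have hR' : (R.map DLetter.b).flatMap τ.map = [] := by
    rw [List.flatMap_map]
    exact h.flatMap_left (fun _ => rfl) fun _ => rfl
  have hT : (T.map DLetter.a).flatMap τ.map = [.y] ++ T := by
    rw [List.flatMap_map]
    exact h.flatMap_right_eq hn rfl (fun i hi => by simp [τ, hi]) fun _ => rfl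
  have hT' : (T.map DLetter.b).flatMap τ.map = [] := by
    rw [List.flatMap_map]
    exact h.flatMap_right (fun _ => rfl) fun _ => rfl
  have hp : τ.Passes (cList R T) l := by
    refine hl.passes_of_eq τ (Or.inr fun g hg => ?_) ?_
    · rcases g with c | c | _ | _ | _ | _ | _
      · rcases c with _ | _ | _ | _ | _ | i
        all_goals try simp [τ] at hg ⊢
        split_ifs at hg ⊢ <;> simp_all
      all_goals simp [τ] at hg ⊢
    · simp only [baseWord, doubleWord, List.flatMap_cons, List.flatMap_append, hR, hR', hT, hT']
      simp [τ, cList]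
  refine ⟨fun h3 => ?_, fun h3 => ?_⟩
  · exact h.not_x_of_ne (a := Letter.z_ i) (by simp) (by simp) (by simp)
      (hp.sublist h3 (by simp [τ]) (by simp))
  · exact h.not_x_of_ne (a := Letter.y_ i) (by simp) (by simp) (by simp)
      (hp.sublist h3 (by simp [τ]) (by simp))

/-- The counterpart of `facts_a_v` for the second copy, with `u` as x and the first y in the image
of `a .t`. -/
theorem facts_b_u (h : IsCBlock n R T) (hn : 1 ≤ n) (hl : Guarded R T l) (i : ℕ) :
    ¬ [DLetter.b (.z_ i), DLetter.u] <+ l ∧ ¬ [DLetter.b (.y_ i), DLetter.u] <+ l := by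
  let τ : WordTest := ⟨[], fun
    | .u => [.x]
    | .a .t => [.y, .t]
    | .b (.z_ i) => [.z_ i]
    | .b (.y_ i) => [.y_ i]
    | .b (.t_ i) => if i = 1 then [.y, .t_ 1] else [.t_ i]
    | _ => []⟩
  have hR : (R.map DLetter.a).flatMap τ.map = [] := by
    rw [List.flatMap_map]
    exact h.flatMap_left (fun _ => rfl) fun _ => rfl
  have hR' : (R.map DLetter.b).flatMap τ.map = R := by
    rw [List.flatMap_map]
    exact h.flatMap_left_eq_self (fun _ => rfl) fun _ => rfl
  have hT : (T.map DLetter.a).flatMap τ.map = [] := by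
    rw [List.flatMap_map]
    exact h.flatMap_right (fun _ => rfl) fun _ => rfl
  have hT' : (T.map DLetter.b).flatMap τ.map = [.y] ++ T := by
    rw [List.flatMap_map]
    exact h.flatMap_right_eq hn rfl (fun i hi => by simp [τ, hi]) fun _ => rfl
  have hp : τ.Passes (cList R T) l := by
    refine hl.passes_of_eq τ (Or.inr fun g hg => ?_) ?_
    · rcases g with c | c | _ | _ | _ | _ | _
      · rcases c with _ | _ | _ | _ | _ | _ <;> simp [τ] at hg ⊢
      · rcases c with _ | _ | _ | _ | _ | i
        all_goals try simp [τ] at hg ⊢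
        split_ifs at hg ⊢ <;> simp_all
      all_goals simp [τ] at hg ⊢
    · simp only [baseWord, doubleWord, List.flatMap_cons, List.flatMap_append, hR, hR', hT, hT']
      simp [τ, cList]
  refine ⟨fun h3 => ?_, fun h3 => ?_⟩
  · exact h.not_x_of_ne (a := Letter.z_ i) (by simp) (by simp) (by simp)
      (hp.sublist h3 (by simp [τ]) (by simp))
  · exact h.not_x_of_ne (a := Letter.y_ i) (by simp) (by simp) (by simp)
      (hp.sublist h3 (by simp [τ]) (by simp))

end Guarded

end

section

open scoped List

/-! ### Interchanging two factors of a word that passes the tests -/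

theorem List.Sublist.pair_of_append {α : Type*} {a b : α} {A B : List α}
    (h : [a, b] <+ A ++ B) (hb : b ∉ B) : [a, b] <+ A := by
  have h1 := h.reverse
  rw [List.reverse_append] at h1
  have h2 := List.Sublist.of_cons_append (a := b) (p := [a]) h1 (by simpa using hb)
  exact List.reverse_sublist.1 h2

/-- The test `τ` is the projection to the copy `ι` of the alphabet. -/
structure WordTest.IsProj (τ : WordTest) (ι : Letter → DLetter) : Prop where
  pre : τ.pre = []
  map : ∀ c, τ.map (ι c) = [c]
  eq_of_mem : ∀ g c, c ∈ τ.map g → g = ι c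

theorem WordTest.isProj_projA : WordTest.projA.IsProj DLetter.a where
  pre := rfl
  map _ := rfl
  eq_of_mem g c hc := by cases g <;> simp [projA] at hc ⊢; exact hc.symm

theorem WordTest.isProj_projB : WordTest.projB.IsProj DLetter.b where
  pre := rfl
  map _ := rfl
  eq_of_mem g c hc := by cases g <;> simp [projB] at hc ⊢; exact hc.symm

namespace WordTest.IsProj

variable {τ : WordTest} {ι : Letter → DLetter} {D : List Letter} {l : List DLetter}

theorem sublist (hτ : τ.IsProj ι) (hp : τ.Passes D l) {p : List Letter} (h : p.map ι <+ l)
    (hc : p.IsChain (· ≠ ·)) : p <+ D :=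
  ListLambda.sublist hp hc (List.sublist_append_skip _ (List.map_sublist_flatMap hτ.map h))

theorem mem (hτ : τ.IsProj ι) (hp : τ.Passes D l) {c : Letter} (h : c ∈ D) : ι c ∈ l := by
  have h1 := (ListLambda.mem_iff hp c).2 h
  rw [hτ.pre, List.nil_append] at h1
  obtain ⟨g, hg, hg'⟩ := List.mem_flatMap.1 h1
  rwa [← hτ.eq_of_mem g c hg']

theorem pair_sublist (hτ : τ.IsProj ι) (hp : τ.Passes D l) {c d : Letter} (hcd : c ≠ d)
    (h : [c, d] <+ D) : [ι c, ι d] <+ l := by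
  have h1 := ListLambda.sublist (ListLambda.symm hp) (by simp [hcd]) h
  rw [hτ.pre, List.nil_append] at h1
  rcases List.mem_flatMap_sublist_pair h1 with ⟨g, k, hg, hk, h2⟩ | ⟨g, -, h2⟩
  · rwa [hτ.eq_of_mem g c hg, hτ.eq_of_mem k d hk] at h2
  · have hg := hτ.eq_of_mem g c (h2.subset (by simp))
    rw [hg, hτ.map] at h2
    simpa using h2.length_le

end WordTest.IsProj

/-- In a word `P (X Y) Q X B Y S`, the letters of `B` also occur in `S`, or in a
block `V` that occurs in `P` or in `Q`, or in a square. -/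
structure SwapConfig (n : ℕ) (P Q B S V : List DLetter) (sq : ℕ → List DLetter) : Prop where
  mem_block : ∀ g ∈ B, g ∈ S ∨ g ∈ V ∨ ∃ k, 1 ≤ k ∧ k < n ∧ g ∈ sq k
  sq_sublist : ∀ k, 1 ≤ k → k < n → sq k ++ sq k <+ B
  subset_V : V ⊆ P ∨ V ⊆ Q

namespace SwapConfig

variable {n : ℕ} {R T : List Letter} {P X Y Q B S V : List DLetter} {sq : ℕ → List DLetter}

theorem two_le_count (hc : SwapConfig n P Q B S V sq) {M : List DLetter} {g : DLetter}
    (hg : g ∈ B) : 2 ≤ (P ++ (M ++ (Q ++ (X ++ (B ++ (Y ++ S)))))).count g := by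
  have h1 := List.count_pos_iff.2 hg
  simp only [List.count_append]
  rcases hc.mem_block g hg with h2 | h2 | ⟨k, hk, hk', h2⟩
  · have := List.count_pos_iff.2 h2
    omega
  · rcases hc.subset_V with h3 | h3
    all_goals
      have := List.count_pos_iff.2 (h3 h2)
      omega
  · have h3 := (hc.sq_sublist k hk hk').count_le g
    have := List.count_pos_iff.2 h2
    rw [List.count_append] at h3
    omega

/-- For a critical pair, no `z_i` or `y_j` may stand before the second X, which pushes `z_1` and all
`y_j` into B; the `y_j` then occupy the squares, one in each. A letter β that is preceded by no
`z_i` or `y_j` thus avoids Y, S and the squares. As α cannot precede x, the pair α, β lies in B, and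
β has no source but V. -/
theorem mem_blocker (h : IsCBlock n R T) (hn : 1 ≤ n) (hc : SwapConfig n P Q B S V sq)
    {τ : WordTest} {ι : Letter → DLetter} (hτ : τ.IsProj ι)
    (hp : τ.Passes (cList R T) (P ++ ((X ++ Y) ++ (Q ++ (X ++ (B ++ (Y ++ S)))))))
    (hX : ι .x ∈ X) (hY : ι .y ∈ Y) {α β : DLetter}
    (h1 : ¬ [α, ι .x] <+ P ++ ((X ++ Y) ++ (Q ++ (X ++ (B ++ (Y ++ S))))))
    (h2 : [α, β] <+ P ++ ((X ++ Y) ++ (Q ++ (X ++ (B ++ (Y ++ S))))))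
    (h3 : ∀ i, ¬ [ι (.z_ i), β] <+ P ++ ((X ++ Y) ++ (Q ++ (X ++ (B ++ (Y ++ S))))))
    (h4 : ∀ i, ¬ [ι (.y_ i), β] <+ P ++ ((X ++ Y) ++ (Q ++ (X ++ (B ++ (Y ++ S)))))) :
    [α, β] <+ B ∧ β ∈ V ∧ β ∉ S ∧ ∀ k, 1 ≤ k → k < n → β ∉ sq k := by
  have eq1 : P ++ ((X ++ Y) ++ (Q ++ (X ++ (B ++ (Y ++ S))))) =
      (P ++ (X ++ (Y ++ Q))) ++ (X ++ (B ++ (Y ++ S))) := by simp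
  have eq2 : P ++ ((X ++ Y) ++ (Q ++ (X ++ (B ++ (Y ++ S))))) =
      (P ++ (X ++ (Y ++ (Q ++ (X ++ (B ++ Y)))))) ++ S := by simp
  have eq3 : P ++ ((X ++ Y) ++ (Q ++ (X ++ (B ++ (Y ++ S))))) =
      (P ++ (X ++ (Y ++ (Q ++ X)))) ++ (B ++ (Y ++ S)) := by simp
  have hpre : ∀ {g}, g ∈ P ++ (X ++ (Y ++ Q)) →
      [g, ι .x] <+ P ++ ((X ++ Y) ++ (Q ++ (X ++ (B ++ (Y ++ S))))) := by
    intro g hg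
    rw [eq1]
    exact List.cons_sublist_append_of_mem hg
      (List.cons_sublist_append_of_mem hX (List.nil_sublist _))
  have hyxy : ∀ {p}, p <+ S → [ι .y, ι .x, ι .y] ++ p <+
      P ++ ((X ++ Y) ++ (Q ++ (X ++ (B ++ (Y ++ S))))) := by
    intro p hpS
    refine List.sublist_append_skip _ (List.cons_sublist_append_of_mem
      (List.mem_append_right _ hY) (List.sublist_append_skip _
        (List.cons_sublist_append_of_mem hX (List.sublist_append_skip _
          (List.cons_sublist_append_of_mem hY ?_)))))
    simpa using hpS
  have hnot : ∀ c, c ≠ Letter.x → c ≠ Letter.y → c ≠ Letter.t →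
      ι c ∉ P ++ (X ++ (Y ++ Q)) := fun c hx hy ht hc' =>
    h.not_x_of_ne hx hy ht (hτ.sublist hp (p := [c, .x]) (hpre hc') (by simp [hx]))
  -- Otherwise `z_1` y would be a subword of S, giving y x y `z_1` y with one y too many.
  have hz : ι (.z_ 1) ∈ B := by
    have h5 := hτ.pair_sublist hp (by simp) (h.z_y_sublist le_rfl hn)
    have h6 := hnot (.z_ 1) (by simp) (by simp) (by simp)
    by_contra hzB
    rw [eq2] at h5
    have h7 := h5.of_cons_append (by simp only [List.mem_append] at h6 ⊢; tauto)
    exact h.not_y_c_y_c_y (hτ.sublist hp (p := [.y, .x, .y, .z_ 1, .y]) (hyxy h7) (by simp))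
  have hyS : ∀ k, ι (.y_ k) ∉ S := fun k hk =>
    h.not_y_x_y_y_ (hτ.sublist hp (p := [.y, .x, .y, .y_ k])
      (hyxy (List.singleton_sublist.2 hk)) (by simp))
  have hsq : ∀ j, 1 ≤ j → j < n → ∃ k, 1 ≤ k ∧ k < n ∧ ι (.y_ j) ∈ sq k := by
    intro j hj hj'
    obtain ⟨A', B', h5, -⟩ := h.exists_splitY hj hj'
    have h6 : ι (.y_ j) ∈ P ++ ((X ++ Y) ++ (Q ++ (X ++ (B ++ (Y ++ S))))) :=
      hτ.mem hp (by simp [h5])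
    have h7 := hnot (.y_ j) (by simp) (by simp) (by simp)
    have h8 := hyS j
    have h9 : ι (.y_ j) ∈ B := by
      simp only [List.mem_append] at h6 h7
      tauto
    rcases hc.mem_block _ h9 with h10 | h10 | h10
    · exact absurd h10 h8
    · rcases hc.subset_V with h11 | h11
      all_goals
        have h12 := h11 h10
        simp only [List.mem_append] at h7
        tauto
    · exact h10
  choose! F hF using hsq
  -- Two different letters `y_j`, `y_j'` in one square would be interleaved, while the occurrences
  -- of each `y_j` in c form a block.
  have hinj : Set.InjOn F (Finset.Ico 1 n) := by
    intro j hj j' hj' hjj'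
    rw [Finset.coe_Ico, Set.mem_Ico] at hj hj'
    by_contra hne
    obtain ⟨hk, hk', h5⟩ := hF j hj.1 hj.2
    have h6 := (hF j' hj'.1 hj'.2).2.2
    rw [← hjj'] at h6
    have h7 : sq (F j) ++ sq (F j) <+ P ++ ((X ++ Y) ++ (Q ++ (X ++ (B ++ (Y ++ S))))) := by
      rw [eq3]
      exact List.sublist_append_skip _ ((hc.sq_sublist _ hk hk').trans
        (List.sublist_append_left _ _))
    have hne' : ι (.y_ j) ≠ ι (.y_ j') := by
      intro h8
      have h9 := hτ.map (.y_ j)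
      rw [h8, hτ.map] at h9
      simp only [List.cons.injEq, Letter.y_.injEq, and_true] at h9
      exact hne h9.symm
    rcases List.exists_pair_sublist hne' h5 h6 with h8 | h8
    · exact h.not_y_c_y_ hj.1 hj.2 (c := .y_ j') (by simpa using Ne.symm hne) (hτ.sublist hp
        (p := [.y_ j, .y_ j', .y_ j])
        (List.Sublist.trans (List.Sublist.append h8 (List.singleton_sublist.2 h5)) h7)
        (by simp [hne, Ne.symm hne]))
    · exact h.not_y_c_y_ hj'.1 hj'.2 (c := .y_ j) (by simpa using hne) (hτ.sublist hp
        (p := [.y_ j', .y_ j, .y_ j'])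
        (List.Sublist.trans (List.Sublist.append h8 (List.singleton_sublist.2 h6)) h7)
        (by simp [hne, Ne.symm hne]))
  -- There are as many squares as letters `y_j`, so every square is occupied.
  have hsurj : Set.SurjOn F (Finset.Ico 1 n) (Finset.Ico 1 n) := by
    refine Finset.surjOn_of_injOn_of_card_le F (fun j hj => ?_) hinj le_rfl
    rw [Finset.coe_Ico, Set.mem_Ico] at hj ⊢
    exact ⟨(hF j hj.1 hj.2).1, (hF j hj.1 hj.2).2.1⟩
  have hβY : β ∉ Y ++ S := fun hβ => h3 1 (by
    rw [eq3]
    exact List.sublist_append_skip _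
      (List.cons_sublist_append_of_mem hz (List.singleton_sublist.2 hβ)))
  have hβS : β ∉ S := fun hβ => hβY (List.mem_append_right _ hβ)
  have hβsq : ∀ k, 1 ≤ k → k < n → β ∉ sq k := by
    intro k hk hk' hβ
    obtain ⟨j, hj, rfl⟩ := hsurj (show k ∈ (Finset.Ico 1 n : Set ℕ) by simp [hk, hk'])
    rw [Finset.coe_Ico, Set.mem_Ico] at hj
    refine h4 j ?_
    rw [eq3]
    refine List.sublist_append_skip _ (List.Sublist.trans ?_
      ((hc.sq_sublist _ hk hk').trans (List.sublist_append_left _ _)))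
    exact List.cons_sublist_append_of_mem (hF j hj.1 hj.2).2.2 (List.singleton_sublist.2 hβ)
  have hα : α ∉ P ++ (X ++ (Y ++ (Q ++ X))) := fun hα => h1 (hpre (by
    simp only [List.mem_append] at hα ⊢
    tauto))
  have hαβ : [α, β] <+ B := by
    rw [eq3] at h2
    exact (h2.of_cons_append hα).pair_of_append hβY
  refine ⟨hαβ, ?_, hβS, hβsq⟩
  rcases hc.mem_block β (hαβ.subset (by simp)) with h5 | h5 | ⟨k, hk, hk', h5⟩
  · exact absurd h5 hβS
  · exact h5
  · exact absurd h5 (hβsq k hk hk')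

/-- By `mem_blocker`, B contains `w` `u` and V contains `u`. Since V recurs in Q, this produces the
forbidden subword t u w u as soon as t lies in P. -/
theorem not_critical_projB (h : IsCBlock n R T) (hn : 1 ≤ n) (hc : SwapConfig n P Q B S V sq)
    (hV : V ⊆ Q) (hl : Guarded R T (P ++ ((X ++ Y) ++ (Q ++ (X ++ (B ++ (Y ++ S)))))))
    (hp : WordTest.projB.Passes (cList R T)
      (P ++ ((X ++ Y) ++ (Q ++ (X ++ (B ++ (Y ++ S)))))))
    (hX : DLetter.b .x ∈ X) : DLetter.b .y ∉ Y := by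
  intro hY
  have h1 := hl.facts_w_u h hn
  obtain ⟨h2, h3, -, -⟩ := mem_blocker h hn hc WordTest.isProj_projB hp hX hY
    (hl.not_w_x h hn) h1.1 (fun i => (hl.facts_b_u h hn i).1) (fun i => (hl.facts_b_u h hn i).2)
  obtain ⟨ht, -, hxt⟩ := hl.facts_of_head h (e := .x) (Or.inl rfl)
  -- The letter x' in the first X may not precede t; a t inside X would recur in the second X.
  have htP : DLetter.a .t ∈ P := by
    by_contra htP
    rw [List.mem_append, or_iff_right htP, List.append_assoc, List.mem_append] at ht
    have h4 : DLetter.a .t ∈ Y ++ (Q ++ (X ++ (B ++ (Y ++ S)))) := by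
      rcases ht with ht | ht
      · simp [ht]
      · exact ht
    refine hxt (List.sublist_append_skip _ ?_)
    rw [List.append_assoc]
    exact List.cons_sublist_append_of_mem hX (List.singleton_sublist.2 h4)
  exact h1.2 (List.cons_sublist_append_of_mem htP (List.sublist_append_skip _
    (List.cons_sublist_append_of_mem (hV h3) (List.sublist_append_skip _
      (h2.trans (List.sublist_append_left _ _))))))

/-- By `mem_blocker`, `v` lies in V and hence in P. So t is also in P, because `v` may not precede
it; but then t is followed by y in Y and x in the second X, against the order in c. -/
theorem not_critical_projA (h : IsCBlock n R T) (hn : 1 ≤ n) (hc : SwapConfig n P Q B S V sq)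
    (hV : V ⊆ P) (hl : Guarded R T (P ++ ((X ++ Y) ++ (Q ++ (X ++ (B ++ (Y ++ S)))))))
    (hp : WordTest.projA.Passes (cList R T)
      (P ++ ((X ++ Y) ++ (Q ++ (X ++ (B ++ (Y ++ S)))))))
    (hX : DLetter.a .x ∈ X) : DLetter.a .y ∉ Y := by
  intro hY
  obtain ⟨h2, h3, -, -⟩ := mem_blocker h hn hc WordTest.isProj_projA hp hX hY
    (hl.facts_of_head h (Or.inl rfl)).2.1 (hl.facts_of_last h (Or.inl rfl)).1
    (fun i => (hl.facts_a_v h hn i).1) (fun i => (hl.facts_a_v h hn i).2)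
  have ht : DLetter.a .t ∈ P ++ ((X ++ Y) ++ (Q ++ (X ++ (B ++ (Y ++ S))))) :=
    WordTest.isProj_projA.mem hp (by simp [cList])
  rcases List.mem_append.1 ht with ht | ht
  · refine h.not_t_y_x (WordTest.isProj_projA.sublist hp (p := [.t, .y, .x]) ?_ (by simp))
    exact List.cons_sublist_append_of_mem ht (List.cons_sublist_append_of_mem
      (List.mem_append_right _ hY) (List.sublist_append_skip _
        (List.cons_sublist_append_of_mem hX (List.nil_sublist _))))
  · exact hl.not_v_t h (List.cons_sublist_append_of_mem (hV h3) (List.singleton_sublist.2 ht))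

/-- A repeated factor A cannot contain both letters. If y precedes x in A, then yxyx arises; if x
precedes y, then `z_1` has no place: it would come before an x, or create a third separated y. -/
theorem not_both_mem (h : IsCBlock n R T) (hn : 1 ≤ n) {U A M W : List DLetter}
    (hp : WordTest.projB.Passes (cList R T) (U ++ (A ++ (M ++ (A ++ W)))))
    (hx : DLetter.b .x ∈ A) : DLetter.b .y ∉ A := by
  intro hy
  have hA : ∀ p q, p <+ A → q <+ A ++ W → p ++ q <+ U ++ (A ++ (M ++ (A ++ W))) :=
    fun p q hp hq => List.sublist_append_skip _ (hp.append (List.sublist_append_skip _ hq))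
  rcases List.exists_pair_sublist (by simp) hx hy with h1 | h1
  · have h2 := WordTest.isProj_projB.pair_sublist hp (by simp) (h.z_y_sublist le_rfl hn)
    have eq : U ++ (A ++ (M ++ (A ++ W))) = (U ++ (A ++ (M ++ A))) ++ W := by simp
    by_cases h3 : DLetter.b (.z_ 1) ∈ U ++ (A ++ (M ++ A))
    · have h4 : DLetter.b (.z_ 1) ∈ U ++ (A ++ M) := by
        simp only [List.mem_append] at h3 ⊢
        tauto
      refine h.not_x_of_ne (a := .z_ 1) (by simp) (by simp) (by simp)
        (WordTest.isProj_projB.sublist hp (p := [.z_ 1, .x]) ?_ (by simp))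
      have eq' : U ++ (A ++ (M ++ (A ++ W))) = (U ++ (A ++ M)) ++ (A ++ W) := by simp
      rw [eq']
      exact List.cons_sublist_append_of_mem h4
        (List.cons_sublist_append_of_mem hx (List.nil_sublist _))
    · rw [eq] at h2
      have h4 := h2.of_cons_append h3
      exact h.not_y_c_y_c_y (WordTest.isProj_projB.sublist hp (p := [.y, .x, .y, .z_ 1, .y])
        (hA [_] _ (List.singleton_sublist.2 hy) (h1.append h4)) (by simp))
  · exact h.not_y_c_y_x (WordTest.isProj_projB.sublist hp (p := [.y, .x, .y, .x])
      (hA _ _ h1 (h1.trans (List.sublist_append_left _ _))) (by simp))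

/-- A critical pair of the first projection forces x' and y' to stand before some `v` inside B,
hence in A₂ or A₁ (the images of the reversed pair y', x'). Each of the four distributions
contradicts the second projection or a guard test. -/
theorem not_critical_projA_of_projB (h : IsCBlock n R T) (hn : 1 ≤ n)
    {A₁ A₂ N S₁ S₂ S₃ : List DLetter}
    (hc : SwapConfig n P Q (A₂ ++ (A₁ ++ (V ++ N))) (S₁ ++ (A₁ ++ (S₂ ++ (A₂ ++ S₃)))) V sq)
    (hN : ∀ g ∈ N, g ∈ S₁ ++ (A₁ ++ (S₂ ++ (A₂ ++ S₃))) ∨ ∃ k, 1 ≤ k ∧ k < n ∧ g ∈ sq k)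
    (hV : V ⊆ Q)
    (hl : Guarded R T (P ++ ((X ++ Y) ++ (Q ++ (X ++ ((A₂ ++ (A₁ ++ (V ++ N))) ++
      (Y ++ (S₁ ++ (A₁ ++ (S₂ ++ (A₂ ++ S₃)))))))))))
    (hpA : WordTest.projA.Passes (cList R T) (P ++ ((X ++ Y) ++ (Q ++ (X ++
      ((A₂ ++ (A₁ ++ (V ++ N))) ++ (Y ++ (S₁ ++ (A₁ ++ (S₂ ++ (A₂ ++ S₃)))))))))))
    (hpB : WordTest.projB.Passes (cList R T) (P ++ ((X ++ Y) ++ (Q ++ (X ++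
      ((A₂ ++ (A₁ ++ (V ++ N))) ++ (Y ++ (S₁ ++ (A₁ ++ (S₂ ++ (A₂ ++ S₃)))))))))))
    (hX : DLetter.a .x ∈ X) : DLetter.a .y ∉ Y := by
  intro hY
  have key : ∀ e, e = Letter.x ∨ e = Letter.y →
      DLetter.v ∈ V ∧ (DLetter.b e ∈ A₂ ∨ DLetter.b e ∈ A₁) := by
    intro e he
    have hex := (hl.facts_of_head h he).2.1
    obtain ⟨h2, h3, h4, h5⟩ := mem_blocker h hn hc WordTest.isProj_projA hpA hX hY
      hex (hl.facts_of_last h he).1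
      (fun i => (hl.facts_a_v h hn i).1) (fun i => (hl.facts_a_v h hn i).2)
    refine ⟨h3, ?_⟩
    have h6 : DLetter.v ∉ N := by
      intro h6
      rcases hN _ h6 with h7 | ⟨k, hk, hk', h7⟩
      · exact h4 h7
      · exact h5 k hk hk' h7
    have h7 : [DLetter.b e, DLetter.v] <+ (A₂ ++ (A₁ ++ V)) ++ N := by simpa using h2
    have h8 : DLetter.b e ∈ A₂ ++ (A₁ ++ V) := (h7.pair_of_append h6).subset (by simp)
    have h9 : DLetter.b e ∉ V := fun h9 => hex (List.sublist_append_skip _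
      (List.sublist_append_skip _ (List.cons_sublist_append_of_mem (hV h9)
        (List.cons_sublist_append_of_mem hX (List.nil_sublist _)))))
    simp only [List.mem_append] at h8
    tauto
  have hv := (key .x (Or.inl rfl)).1
  rcases (key .x (Or.inl rfl)).2 with hx | hx <;> rcases (key .y (Or.inr rfl)).2 with hy | hy
  · refine not_both_mem h hn (U := P ++ ((X ++ Y) ++ (Q ++ X)))
      (M := A₁ ++ (V ++ (N ++ (Y ++ (S₁ ++ (A₁ ++ S₂)))))) (W := S₃) ?_ hx hy
    simpa using hpB
  -- Here A₁ carries y' and A₂ carries x'; the later occurrences of A₁ and A₂ come in this order, so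
  -- two y' precede an x'.
  · have h1 : [DLetter.b .y, DLetter.b .y, DLetter.b .x] <+ (P ++ ((X ++ Y) ++ (Q ++ (X ++
      ((A₂ ++ (A₁ ++ (V ++ N))) ++ (Y ++ (S₁ ++ (A₁ ++ (S₂ ++ (A₂ ++ S₃)))))))))) := by
      refine List.sublist_append_skip _ (List.sublist_append_skip _ (List.sublist_append_skip _
        (List.sublist_append_skip _ (List.cons_sublist_append_of_mem (by simp [hy])
          (List.sublist_append_skip _ (List.sublist_append_skip _
            (List.cons_sublist_append_of_mem hy (List.sublist_append_skip _
              (List.cons_sublist_append_of_mem hx (List.nil_sublist _))))))))))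
    have h2 : [Letter.y, Letter.y, Letter.x] <+ _ :=
      List.sublist_append_skip WordTest.projB.pre
        (List.map_sublist_flatMap (f := WordTest.projB.map) (ι := DLetter.b) (fun _ => rfl) h1)
    obtain ⟨c, hcy, h3⟩ := exists_sublist_of_not_firstTwoAdjacent
      (ListLambda.not_firstTwoAdjacent hpB IsCBlock.not_firstTwoAdjacent_y) h2
    exact h.not_y_c_y_x (ListLambda.sublist hpB (by simp [hcy, hcy.symm]) h3)
  -- Here A₂ carries y' and A₁ carries x', as under the identity substitution. B therefore contains
  -- y'x': a later t' gives y'x't', and an earlier one precedes `v`. With x'y' unreversed this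
  -- contradiction would be lost.
  · have ht := WordTest.isProj_projB.mem hpB (c := .t) (by simp [cList])
    have eq : (P ++ ((X ++ Y) ++ (Q ++ (X ++
      ((A₂ ++ (A₁ ++ (V ++ N))) ++ (Y ++ (S₁ ++ (A₁ ++ (S₂ ++ (A₂ ++ S₃)))))))))) =
      (P ++ ((X ++ Y) ++ (Q ++ (X ++ (A₂ ++ A₁))))) ++
        (V ++ (N ++ (Y ++ (S₁ ++ (A₁ ++ (S₂ ++ (A₂ ++ S₃))))))) := by simp
    have h1 := (hl.facts_of_last h (Or.inl rfl)).2
    rw [eq] at ht h1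
    rcases List.mem_append.1 ht with ht | ht
    · exact h1 (List.cons_sublist_append_of_mem ht
        (List.cons_sublist_append_of_mem hv (List.nil_sublist _)))
    · refine h.not_y_x_t (WordTest.isProj_projB.sublist hpB (p := [.y, .x, .t]) ?_ (by simp))
      rw [eq]
      refine List.Sublist.append (l₁ := [DLetter.b .y, DLetter.b .x]) ?_
        (List.singleton_sublist.2 ht)
      exact List.sublist_append_skip _ (List.sublist_append_skip _ (List.sublist_append_skip _
        (List.sublist_append_skip _ (List.cons_sublist_append_of_mem hy
          (List.singleton_sublist.2 hx)))))
  · refine not_both_mem h hn (U := P ++ ((X ++ Y) ++ (Q ++ (X ++ A₂))))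
      (M := V ++ (N ++ (Y ++ S₁))) (W := S₂ ++ (A₂ ++ S₃)) ?_ hx hy
    simpa using hpB

end SwapConfig

end

section

open scoped List

/-! ### Sets of words that are given by tests -/

namespace SwapConfig

variable {n : ℕ} {R T : List Letter} {P X Y Q B S V : List DLetter} {sq : ℕ → List DLetter}

theorem count_flatMap_ne_one (hc : SwapConfig n P Q B S V sq) (τ : WordTest)
    {M : List DLetter} {c : Letter} (hcB : c ∈ B.flatMap τ.map) :
    (τ.pre ++ (P ++ (M ++ (Q ++ (X ++ (B ++ (Y ++ S)))))).flatMap τ.map).count c ≠ 1 := by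
  obtain ⟨g, hg, hcg⟩ := List.mem_flatMap.1 hcB
  have := List.count_flatMap_pos_two (hc.two_le_count (X := X) (Y := Y) (M := M) hg) hcg
  rw [List.count_append]
  omega

theorem passes_swap (h : IsCBlock n R T) (hc : SwapConfig n P Q B S V sq) {τ : WordTest}
    (hp : τ.Passes (cList R T) (P ++ ((X ++ Y) ++ (Q ++ (X ++ (B ++ (Y ++ S)))))))
    (hne : ¬ (Letter.x ∈ X.flatMap τ.map ∧ Letter.y ∈ Y.flatMap τ.map)) :
    τ.Passes (cList R T) (P ++ ((Y ++ X) ++ (Q ++ (X ++ (B ++ (Y ++ S)))))) := by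
  have hcount := fun c hcB => hc.count_flatMap_ne_one (X := X) (Y := Y) (M := X ++ Y) τ (c := c) hcB
  simp only [WordTest.Passes, List.flatMap_append, ← List.append_assoc τ.pre] at hp hcount ⊢
  rcases h.append_comm_or_mem hp hcount with h1 | h1
  · rwa [← h1]
  · exact absurd h1 hne

theorem passes_of_swapped (h : IsCBlock n R T) (hc : SwapConfig n P Q B S V sq) {τ : WordTest}
    (hp : τ.Passes (cList R T) (P ++ ((Y ++ X) ++ (Q ++ (X ++ (B ++ (Y ++ S))))))) :
    τ.Passes (cList R T) (P ++ ((X ++ Y) ++ (Q ++ (X ++ (B ++ (Y ++ S)))))) := by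
  have hcount := fun c hcB => hc.count_flatMap_ne_one (X := X) (Y := Y) (M := Y ++ X) τ (c := c) hcB
  simp only [WordTest.Passes, List.flatMap_append, ← List.append_assoc τ.pre] at hp hcount ⊢
  rwa [h.append_comm_of_swapped hp hcount]

/-- X and Y both occur twice, so their images contain no letter that is simple in c, whereas a
noncritical test ties x or y to such a letter. -/
theorem not_critical_of_noncritical (h : IsCBlock n R T) (hn : 1 ≤ n) {τ : WordTest}
    (hτ : τ.Noncritical)
    (hp : τ.Passes (cList R T) (P ++ ((X ++ Y) ++ (Q ++ (X ++ (B ++ (Y ++ S))))))) :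
    ¬ (Letter.x ∈ X.flatMap τ.map ∧ Letter.y ∈ Y.flatMap τ.map) := by
  rintro ⟨hx, hy⟩
  have key : ∀ s, (cList R T).count s = 1 →
      s ∉ X.flatMap τ.map ∧ s ∉ Y.flatMap τ.map := by
    intro s hs
    have h1 := ListLambda.count_eq_one hp hs
    simp only [List.flatMap_append, List.count_append] at h1
    constructor
    all_goals
      intro h2
      have := List.count_pos_iff.2 h2
      omega
  obtain ⟨g, hg, hxg⟩ := List.mem_flatMap.1 hx
  obtain ⟨k, hk, hyk⟩ := List.mem_flatMap.1 hy
  rcases hτ with hτ | hτ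
  · exact (key _ h.count_t).1 (List.mem_flatMap.2 ⟨g, hg, hτ g hxg⟩)
  · rcases hτ k hyk with h1 | h1
    · exact (key _ h.count_t).2 (List.mem_flatMap.2 ⟨k, hk, h1⟩)
    · exact (key _ (h.count_t_ le_rfl hn)).2 (List.mem_flatMap.2 ⟨k, hk, h1⟩)

theorem guarded_iff (h : IsCBlock n R T) (hn : 1 ≤ n) (hc : SwapConfig n P Q B S V sq) :
    Guarded R T (P ++ ((X ++ Y) ++ (Q ++ (X ++ (B ++ (Y ++ S)))))) ↔
      Guarded R T (P ++ ((Y ++ X) ++ (Q ++ (X ++ (B ++ (Y ++ S)))))) :=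
  ⟨fun hl τ h1 h2 => hc.passes_swap h (hl τ h1 h2)
    (not_critical_of_noncritical h hn h1 (hl τ h1 h2)),
    fun hl τ h1 h2 => hc.passes_of_swapped h (hl τ h1 h2)⟩

theorem guarded_projA_iff (h : IsCBlock n R T) (hn : 1 ≤ n) (hc : SwapConfig n P Q B S V sq)
    (hV : V ⊆ P) :
    (Guarded R T (P ++ ((X ++ Y) ++ (Q ++ (X ++ (B ++ (Y ++ S)))))) ∧
      WordTest.projA.Passes (cList R T) (P ++ ((X ++ Y) ++ (Q ++ (X ++ (B ++ (Y ++ S))))))) ↔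
    (Guarded R T (P ++ ((Y ++ X) ++ (Q ++ (X ++ (B ++ (Y ++ S)))))) ∧
      WordTest.projA.Passes (cList R T) (P ++ ((Y ++ X) ++ (Q ++ (X ++ (B ++ (Y ++ S))))))) := by
  refine ⟨fun hl => ⟨(hc.guarded_iff h hn).1 hl.1, hc.passes_swap h hl.2 ?_⟩,
    fun hl => ⟨(hc.guarded_iff h hn).2 hl.1, hc.passes_of_swapped h hl.2⟩⟩
  rintro ⟨hx, hy⟩
  obtain ⟨g, hg, hxg⟩ := List.mem_flatMap.1 hx
  obtain ⟨k, hk, hyk⟩ := List.mem_flatMap.1 hy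
  rw [WordTest.isProj_projA.eq_of_mem _ _ hxg] at hg
  rw [WordTest.isProj_projA.eq_of_mem _ _ hyk] at hk
  exact hc.not_critical_projA h hn hV hl.1 hl.2 hg hk

theorem guarded_projB_iff (h : IsCBlock n R T) (hn : 1 ≤ n) (hc : SwapConfig n P Q B S V sq)
    (hV : V ⊆ Q) :
    (Guarded R T (P ++ ((X ++ Y) ++ (Q ++ (X ++ (B ++ (Y ++ S)))))) ∧
      WordTest.projB.Passes (cList R T) (P ++ ((X ++ Y) ++ (Q ++ (X ++ (B ++ (Y ++ S))))))) ↔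
    (Guarded R T (P ++ ((Y ++ X) ++ (Q ++ (X ++ (B ++ (Y ++ S)))))) ∧
      WordTest.projB.Passes (cList R T) (P ++ ((Y ++ X) ++ (Q ++ (X ++ (B ++ (Y ++ S))))))) := by
  refine ⟨fun hl => ⟨(hc.guarded_iff h hn).1 hl.1, hc.passes_swap h hl.2 ?_⟩,
    fun hl => ⟨(hc.guarded_iff h hn).2 hl.1, hc.passes_of_swapped h hl.2⟩⟩
  rintro ⟨hx, hy⟩
  obtain ⟨g, hg, hxg⟩ := List.mem_flatMap.1 hx
  obtain ⟨k, hk, hyk⟩ := List.mem_flatMap.1 hy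
  rw [WordTest.isProj_projB.eq_of_mem _ _ hxg] at hg
  rw [WordTest.isProj_projB.eq_of_mem _ _ hyk] at hk
  exact hc.not_critical_projB h hn hV hl.1 hl.2 hg hk

theorem passes_projA_iff {A₁ A₂ N S₁ S₂ S₃ : List DLetter} (h : IsCBlock n R T) (hn : 1 ≤ n)
    (hc : SwapConfig n P Q (A₂ ++ (A₁ ++ (V ++ N))) (S₁ ++ (A₁ ++ (S₂ ++ (A₂ ++ S₃)))) V sq)
    (hN : ∀ g ∈ N, g ∈ S₁ ++ (A₁ ++ (S₂ ++ (A₂ ++ S₃))) ∨ ∃ k, 1 ≤ k ∧ k < n ∧ g ∈ sq k)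
    (hV : V ⊆ Q)
    (hl : Guarded R T (P ++ ((X ++ Y) ++ (Q ++ (X ++ ((A₂ ++ (A₁ ++ (V ++ N))) ++
      (Y ++ (S₁ ++ (A₁ ++ (S₂ ++ (A₂ ++ S₃)))))))))))
    (hpB : WordTest.projB.Passes (cList R T) (P ++ ((X ++ Y) ++ (Q ++ (X ++
      ((A₂ ++ (A₁ ++ (V ++ N))) ++ (Y ++ (S₁ ++ (A₁ ++ (S₂ ++ (A₂ ++ S₃))))))))))) :
    WordTest.projA.Passes (cList R T) (P ++ ((X ++ Y) ++ (Q ++ (X ++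
      ((A₂ ++ (A₁ ++ (V ++ N))) ++ (Y ++ (S₁ ++ (A₁ ++ (S₂ ++ (A₂ ++ S₃)))))))))) ↔
    WordTest.projA.Passes (cList R T) (P ++ ((Y ++ X) ++ (Q ++ (X ++
      ((A₂ ++ (A₁ ++ (V ++ N))) ++ (Y ++ (S₁ ++ (A₁ ++ (S₂ ++ (A₂ ++ S₃)))))))))) := by
  refine ⟨fun hp => hc.passes_swap h hp ?_, fun hp => hc.passes_of_swapped h hp⟩
  rintro ⟨hx, hy⟩
  obtain ⟨g, hg, hxg⟩ := List.mem_flatMap.1 hx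
  obtain ⟨k, hk, hyk⟩ := List.mem_flatMap.1 hy
  rw [WordTest.isProj_projA.eq_of_mem _ _ hxg] at hg
  rw [WordTest.isProj_projA.eq_of_mem _ _ hyk] at hk
  exact not_critical_projA_of_projB h hn hc hN hV hl hp hpB hg hk

end SwapConfig

/-! ### Substitutions in the words `doubleWord` -/

/-- The words `xy` and `yx` over the copy `ι` of the alphabet. -/
def orderedPair (ι : Letter → DLetter) (s : Bool) : List DLetter :=
  if s then [ι .y, ι .x] else [ι .x, ι .y]

section Substitution

variable {n : ℕ} {R T : List Letter} (φ : DLetter → List DLetter) (p s : List DLetter)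

/-- Each `z_i` of R recurs in T; the other letters of R are the squared `y_k`. -/
theorem IsCBlock.mem_flatMap_map (h : IsCBlock n R T) (ι : Letter → DLetter) {g : DLetter}
    (hg : g ∈ (R.map ι).flatMap φ) :
    g ∈ (T.map ι).flatMap φ ∨ ∃ k, 1 ≤ k ∧ k < n ∧ g ∈ φ (ι (.y_ k)) := by
  rw [List.flatMap_map] at hg ⊢
  obtain ⟨c, hc, hg⟩ := List.mem_flatMap.1 hg
  rcases h.memR c hc with ⟨i, h1, h2, rfl⟩ | ⟨k, h1, h2, rfl⟩
  · obtain ⟨A, B, hT, -⟩ := h.splitT i h1 h2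
    exact Or.inl (List.mem_flatMap.2 ⟨_, by simp [hT], hg⟩)
  · exact Or.inr ⟨k, h1, h2, hg⟩

theorem IsCBlock.sq_sublist (h : IsCBlock n R T) (ι : Letter → DLetter) {k : ℕ} (h1 : 1 ≤ k)
    (h2 : k < n) : φ (ι (.y_ k)) ++ φ (ι (.y_ k)) <+ (R.map ι).flatMap φ := by
  obtain ⟨A, B, hR, -⟩ := h.splitY k h1 h2
  have h3 : [ι (.y_ k), ι (.y_ k)] <+ R.map ι := by
    rw [hR, List.map_append]
    exact List.sublist_append_skip _ (by simp)
  simpa using h3.flatMap φ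

/-- The image of `doubleWord R T X₁ X₂` from the second letter `y` on. -/
def tailA (R T : List Letter) : List DLetter :=
  (T.map DLetter.a).flatMap φ ++ (φ (.b .t) ++ (φ (.b .x) ++ ((φ .w ++ (φ .u ++
    (R.map DLetter.b).flatMap φ)) ++ (φ (.b .y) ++ (φ .q ++ (φ .w ++
      ((T.map DLetter.b).flatMap φ ++ s)))))))

theorem flatMap_doubleWord_left (X₂ : List DLetter) (e : Bool) :
    p ++ (doubleWord R T (orderedPair .a e) X₂).flatMap φ ++ s =
      (p ++ φ .u) ++ ((if e then φ (.a .y) ++ φ (.a .x) else φ (.a .x) ++ φ (.a .y)) ++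
        ((φ (.a .t) ++ (φ .v ++ φ .p)) ++ (φ (.a .x) ++
          ((X₂.flatMap φ ++ (φ .v ++ (R.map DLetter.a).flatMap φ)) ++
            (φ (.a .y) ++ tailA φ s R T))))) := by
  cases e <;> simp [doubleWord, orderedPair, tailA]

theorem flatMap_doubleWord_right (X₁ : List DLetter) (e : Bool) :
    p ++ (doubleWord R T X₁ (orderedPair .b e)).flatMap φ ++ s =
      (p ++ (φ .u ++ (X₁.flatMap φ ++ (φ (.a .t) ++ (φ .v ++ (φ .p ++ φ (.a .x))))))) ++
        ((if e then φ (.b .y) ++ φ (.b .x) else φ (.b .x) ++ φ (.b .y)) ++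
        ((φ .v ++ ((R.map DLetter.a).flatMap φ ++ (φ (.a .y) ++
          ((T.map DLetter.a).flatMap φ ++ φ (.b .t))))) ++ (φ (.b .x) ++
          ((φ .w ++ (φ .u ++ (R.map DLetter.b).flatMap φ)) ++
            (φ (.b .y) ++ (φ .q ++ (φ .w ++ ((T.map DLetter.b).flatMap φ ++ s)))))))) := by
  cases e <;> simp [doubleWord, orderedPair]

theorem swapConfig_left (h : IsCBlock n R T) (e : Bool) :
    SwapConfig n (p ++ φ .u) (φ (.a .t) ++ (φ .v ++ φ .p))
      ((orderedPair .b e).flatMap φ ++ (φ .v ++ (R.map DLetter.a).flatMap φ)) (tailA φ s R T)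
      (φ .v) fun k => φ (.a (.y_ k)) where
  mem_block g hg := by
    rcases List.mem_append.1 hg with hg | hg
    · left
      have : g ∈ φ (.b .x) ∨ g ∈ φ (.b .y) := by
        cases e <;> simp [orderedPair] at hg <;> tauto
      simp only [tailA, List.mem_append]
      tauto
    · rcases List.mem_append.1 hg with hg | hg
      · exact Or.inr (Or.inl hg)
      · rcases h.mem_flatMap_map φ _ hg with h1 | h1
        · exact Or.inl (List.mem_append_left _ h1)
        · exact Or.inr (Or.inr h1)
  sq_sublist k h1 h2 :=
    List.sublist_append_skip _ (List.sublist_append_skip _ (h.sq_sublist φ _ h1 h2))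
  subset_V := Or.inr fun g hg => by simp [hg]

theorem swapConfig_right (h : IsCBlock n R T) (X₁ : List DLetter) :
    SwapConfig n
      (p ++ (φ .u ++ (X₁.flatMap φ ++ (φ (.a .t) ++ (φ .v ++ (φ .p ++ φ (.a .x)))))))
      (φ .v ++ ((R.map DLetter.a).flatMap φ ++ (φ (.a .y) ++
          ((T.map DLetter.a).flatMap φ ++ φ (.b .t)))))
      (φ .w ++ (φ .u ++ (R.map DLetter.b).flatMap φ))
      (φ .q ++ (φ .w ++ ((T.map DLetter.b).flatMap φ ++ s)))
      (φ .u) fun k => φ (.b (.y_ k)) where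
  mem_block g hg := by
    rcases List.mem_append.1 hg with hg | hg
    · exact Or.inl (by simp [hg])
    · rcases List.mem_append.1 hg with hg | hg
      · exact Or.inr (Or.inl hg)
      · rcases h.mem_flatMap_map φ _ hg with h1 | h1
        · left
          simp only [List.mem_append]
          tauto
        · exact Or.inr (Or.inr h1)
  sq_sublist k h1 h2 :=
    List.sublist_append_skip _ (List.sublist_append_skip _ (h.sq_sublist φ _ h1 h2))
  subset_V := Or.inl fun g hg => by simp [hg]

theorem projB_left_iff (h : IsCBlock n R T) (hn : 1 ≤ n) (e : Bool) :
    (Guarded R T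
        (p ++ (doubleWord R T (orderedPair .a false) (orderedPair .b e)).flatMap φ ++ s) ∧
      WordTest.projB.Passes (cList R T)
        (p ++ (doubleWord R T (orderedPair .a false) (orderedPair .b e)).flatMap φ ++ s)) ↔
    (Guarded R T
        (p ++ (doubleWord R T (orderedPair .a true) (orderedPair .b e)).flatMap φ ++ s) ∧
      WordTest.projB.Passes (cList R T)
        (p ++ (doubleWord R T (orderedPair .a true) (orderedPair .b e)).flatMap φ ++ s)) := by
  rw [flatMap_doubleWord_left, flatMap_doubleWord_left]
  exact (swapConfig_left φ p s h e).guarded_projB_iff h hn fun g hg => by simp [hg]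

theorem projA_right_iff (h : IsCBlock n R T) (hn : 1 ≤ n) (X₁ : List DLetter) :
    (Guarded R T (p ++ (doubleWord R T X₁ (orderedPair .b false)).flatMap φ ++ s) ∧
      WordTest.projA.Passes (cList R T)
        (p ++ (doubleWord R T X₁ (orderedPair .b false)).flatMap φ ++ s)) ↔
    (Guarded R T (p ++ (doubleWord R T X₁ (orderedPair .b true)).flatMap φ ++ s) ∧
      WordTest.projA.Passes (cList R T)
        (p ++ (doubleWord R T X₁ (orderedPair .b true)).flatMap φ ++ s)) := by
  rw [flatMap_doubleWord_right, flatMap_doubleWord_right]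
  exact (swapConfig_right φ p s h X₁).guarded_projA_iff h hn fun g hg => by simp [hg]

theorem projA_left_iff (h : IsCBlock n R T) (hn : 1 ≤ n)
    (hl : Guarded R T
      (p ++ (doubleWord R T (orderedPair .a false) (orderedPair .b true)).flatMap φ ++ s))
    (hp : WordTest.projB.Passes (cList R T)
      (p ++ (doubleWord R T (orderedPair .a false) (orderedPair .b true)).flatMap φ ++ s)) :
    WordTest.projA.Passes (cList R T)
      (p ++ (doubleWord R T (orderedPair .a false) (orderedPair .b true)).flatMap φ ++ s) ↔
    WordTest.projA.Passes (cList R T)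
      (p ++ (doubleWord R T (orderedPair .a true) (orderedPair .b true)).flatMap φ ++ s) := by
  have hc := swapConfig_left φ p s h true
  -- The reversed pair supplies A₂ = φ(y') and A₁ = φ(x').
  have eqB : (orderedPair .b true).flatMap φ ++ (φ .v ++ (R.map DLetter.a).flatMap φ) =
      φ (.b .y) ++ (φ (.b .x) ++ (φ .v ++ (R.map DLetter.a).flatMap φ)) := by
    simp [orderedPair]
  have eqS : tailA φ s R T = ((T.map DLetter.a).flatMap φ ++ φ (.b .t)) ++ (φ (.b .x) ++
      ((φ .w ++ (φ .u ++ (R.map DLetter.b).flatMap φ)) ++ (φ (.b .y) ++ (φ .q ++ (φ .w ++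
      ((T.map DLetter.b).flatMap φ ++ s)))))) := by
    simp [tailA]
  rw [flatMap_doubleWord_left] at hl hp ⊢
  rw [flatMap_doubleWord_left]
  rw [eqB, eqS] at hl hp hc ⊢
  refine hc.passes_projA_iff h hn (fun g hg => ?_) (fun g hg => by simp [hg]) hl hp
  rcases h.mem_flatMap_map φ _ hg with h1 | h1
  · exact Or.inl (List.mem_append_left _ (List.mem_append_left _ h1))
  · exact Or.inr h1

end Substitution

end

/-! ### Syntactic monoids -/

/-- The syntactic congruence of a set of words. -/
def syntacticCon {α : Type} (K : Set (FreeMonoid α)) : Con (FreeMonoid α) where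
  r u v := ∀ p s, p * u * s ∈ K ↔ p * v * s ∈ K
  iseqv :=
    { refl := fun _ _ _ => Iff.rfl
      symm := fun h p s => (h p s).symm
      trans := fun h h' p s => (h p s).trans (h' p s) }
  mul' := by
    intro u v u' v' h h' p s
    have h1 := h p (u' * s)
    have h2 := h' (p * v) s
    simp only [mul_assoc] at h1 h2 ⊢
    exact h1.trans h2

/-- Evaluations in a quotient of a free monoid lift to substitutions in the free monoid itself. -/
theorem satisfiesIdentity_syntacticCon_iff {α : Type} (K : Set (FreeMonoid α)) (e : Word × Word) :
    SatisfiesIdentity (syntacticCon K).Quotient e ↔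
      ∀ Φ : Word →* FreeMonoid α, syntacticCon K (Φ e.1) (Φ e.2) := by
  constructor
  · intro h Φ
    have h1 := h fun c => (Φ (FreeMonoid.of c) : (syntacticCon K).Quotient)
    have h2 : FreeMonoid.lift (fun c => (Φ (FreeMonoid.of c) : (syntacticCon K).Quotient)) =
        (syntacticCon K).mk'.comp Φ := FreeMonoid.hom_eq fun c => by simp
    rw [h2] at h1
    exact (Con.eq _).1 h1
  · intro h φ
    choose ψ hψ using fun c => Con.mk'_surjective (c := syntacticCon K) (φ c)
    have h2 : FreeMonoid.lift φ = (syntacticCon K).mk'.comp (FreeMonoid.lift ψ) :=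
      FreeMonoid.hom_eq fun c => by simp [← hψ]
    rw [h2]
    exact (Con.eq _).2 (h (FreeMonoid.lift ψ))

/-! ### Varieties and their identities -/

namespace MonoidVariety

/-- The variety defined by one identity. -/
def ofIdentity (e : Word × Word) : MonoidVariety where
  carrier := {M | SatisfiesIdentity M e}
  equational := ⟨{e}, by simp⟩

theorem mem_generatedBy (M : Type) [Monoid M] : MonCat.of M ∈ (generatedBy M).carrier :=
  fun _ hV => hV

theorem generatedBy_le_iff {M : Type} [Monoid M] {V : MonoidVariety} :
    generatedBy M ≤ V ↔ MonCat.of M ∈ V.carrier :=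
  ⟨fun h => h (mem_generatedBy M), fun h _ hN => hN V h⟩

theorem mem_of_forall_satisfies {V : MonoidVariety} {N : MonCat.{0}}
    (h : ∀ e, (∀ M ∈ V.carrier, SatisfiesIdentity M e) → SatisfiesIdentity N e) :
    N ∈ V.carrier := by
  obtain ⟨E, hE⟩ := V.equational
  rw [hE]
  intro e he
  refine h e fun M hM => ?_
  rw [hE] at hM
  exact hM e he

end MonoidVariety

/-! ### The varieties generated by the syntactic monoids -/

/-- The set of words that pass the tests of a family. -/
def passSet (D : List Letter) (F : Set WordTest) : Set (FreeMonoid DLetter) :=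
  {l | ∀ τ ∈ F, τ.Passes D l.toList}

/-- Passing a test in the context p, s means that the class of the image times fixed factors equals
the class of `w`. An identity of `M_λ` cannot change the truth of this. -/
theorem syntacticCon_passSet_of_satisfies {w : Word} {F : Set WordTest} {e : Word × Word}
    (he : SatisfiesIdentity (MAlpha lambdaCon {(w : lambdaCon.Quotient)}) e)
    (Φ : Word →* FreeMonoid DLetter) : syntacticCon (passSet w.toList F) (Φ e.1) (Φ e.2) := by
  intro p s
  refine forall₂_congr fun τ hτ => ?_
  let σ : FreeMonoid DLetter →* Word :=
    FreeMonoid.lift fun g => FreeMonoid.ofList (τ.map g)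
  have hσ : ∀ l : FreeMonoid DLetter, FreeMonoid.ofList (l.toList.flatMap τ.map) = σ l := by
    intro l
    simp only [σ, FreeMonoid.lift_apply]
    rw [List.flatMap_def, FreeMonoid.ofList_flatten, List.map_map]
    rfl
  have hpass : ∀ u : FreeMonoid DLetter, τ.Passes w.toList (p * u * s).toList ↔
      ((FreeMonoid.ofList τ.pre * σ p : Word) : lambdaCon.Quotient) * (σ u : Word) * (σ s : Word) =
        (w : lambdaCon.Quotient) := by
    intro u
    rw [← Con.coe_mul, ← Con.coe_mul, Con.eq]
    have : FreeMonoid.ofList (τ.pre ++ (p * u * s).toList.flatMap τ.map) =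
        FreeMonoid.ofList τ.pre * σ p * σ u * σ s := by
      rw [FreeMonoid.ofList_append, hσ, map_mul, map_mul]
      simp only [mul_assoc]
    rw [WordTest.Passes, ListLambda, this]
    rfl
  have h1 := he fun c =>
    (((σ (Φ (FreeMonoid.of c)) : Word) : lambdaCon.Quotient)
      : MAlpha lambdaCon {(w : lambdaCon.Quotient)})
  have h2 : ∀ v : Word, FreeMonoid.lift (fun c => (((σ (Φ (FreeMonoid.of c)) : Word) :
      lambdaCon.Quotient) : MAlpha lambdaCon {(w : lambdaCon.Quotient)})) v =
      (((σ (Φ v) : Word) : lambdaCon.Quotient) : MAlpha lambdaCon {(w : lambdaCon.Quotient)}) := by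
    intro v
    have : FreeMonoid.lift (fun c => (((σ (Φ (FreeMonoid.of c)) : Word) :
        lambdaCon.Quotient) : MAlpha lambdaCon {(w : lambdaCon.Quotient)})) =
        ((Con.mk' _).comp (lambdaCon.mk'.comp (σ.comp Φ))) := FreeMonoid.hom_eq fun c => by simp
    rw [this]
    rfl
  rw [h2, h2, Con.eq] at h1
  rw [hpass, hpass]
  -- In the Rees quotient either the two classes agree, or neither is a factor of the class of `w`
  -- and then neither word passes.
  rcases h1 with h1 | ⟨h1, h3⟩
  · rw [h1]
  · constructor
    · intro h4
      exact absurd ⟨_, rfl, _, _, h4.symm⟩ h1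
    · intro h4
      exact absurd ⟨_, rfl, _, _, h4.symm⟩ h3

theorem syntacticCon_passSet_mem_varMLambda (w : Word) (F : Set WordTest) :
    MonCat.of (syntacticCon (passSet w.toList F)).Quotient ∈ (varMLambda w).carrier := by
  refine MonoidVariety.mem_of_forall_satisfies fun e he => ?_
  rw [satisfiesIdentity_syntacticCon_iff]
  exact syntacticCon_passSet_of_satisfies (he _ (MonoidVariety.mem_generatedBy _))

/-- The language of a union of families is the intersection of their languages, so its syntactic
congruence contains the intersection of theirs. -/
theorem mem_sup_of_passSet_inter {D : List Letter} {F G : Set WordTest} :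
    MonCat.of (syntacticCon (passSet D (F ∪ G))).Quotient ∈
      (MonoidVariety.generatedBy (syntacticCon (passSet D F)).Quotient ⊔
        MonoidVariety.generatedBy (syntacticCon (passSet D G)).Quotient).carrier := by
  refine MonoidVariety.mem_of_forall_satisfies fun e he => ?_
  have h1 := he _ ((le_sup_left : _ ≤ MonoidVariety.generatedBy (syntacticCon (passSet D
    F)).Quotient ⊔
        MonoidVariety.generatedBy (syntacticCon (passSet D G)).Quotient)
          (MonoidVariety.mem_generatedBy _))
  have h2 := he _ ((le_sup_right : _ ≤ MonoidVariety.generatedBy (syntacticCon (passSet D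
    F)).Quotient ⊔
        MonoidVariety.generatedBy (syntacticCon (passSet D G)).Quotient)
          (MonoidVariety.mem_generatedBy _))
  rw [satisfiesIdentity_syntacticCon_iff] at h1 h2 ⊢
  intro Φ p s
  have h3 : passSet D (F ∪ G) = passSet D F ∩ passSet D G := by
    ext l
    simp only [passSet, Set.mem_union, Set.mem_ofPred_eq, Set.mem_inter_iff, or_imp, forall_and]
  rw [h3]
  exact and_congr (h1 Φ p s) (h2 Φ p s)

instance : Countable DLetter := by
  obtain ⟨f, hf⟩ := exists_injective_nat Letter
  let g : DLetter → ℕ × ℕ := fun a => match a with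
    | .a c => (0, f c)
    | .b c => (1, f c)
    | .u => (2, 0)
    | .v => (3, 0)
    | .w => (4, 0)
    | .p => (5, 0)
    | .q => (6, 0)
  have hg : Function.Injective g := by
    intro a b h
    cases a <;> cases b <;> simp_all [g, hf.eq_iff]
  exact hg.countable

instance : Nonempty DLetter := ⟨.u⟩

theorem exists_injective_dLetter : ∃ ε : DLetter → Letter, Function.Injective ε := by
  obtain ⟨f, hf⟩ := exists_injective_nat DLetter
  exact ⟨fun a => Letter.z_ (f a), fun a b h => hf (Letter.z_.inj h)⟩

theorem toList_map_free {ε : DLetter → Letter} (Φ : Word →* FreeMonoid DLetter)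
    (l : List DLetter) : (Φ (FreeMonoid.map ε (FreeMonoid.ofList l))).toList =
      l.flatMap fun g => (Φ (FreeMonoid.of (ε g))).toList := by
  induction l with
  | nil => simp
  | cons a l ih =>
    rw [FreeMonoid.ofList_cons, map_mul, map_mul, FreeMonoid.toList_mul, ih, FreeMonoid.map_of]
    simp

theorem syntacticCon_passSet_map {D : List Letter} {F : Set WordTest} {ε : DLetter → Letter}
    {l l' : List DLetter}
    (h : ∀ (φ : DLetter → List DLetter) (p s : List DLetter),
      (∀ τ ∈ F, τ.Passes D (p ++ l.flatMap φ ++ s)) ↔ ∀ τ ∈ F, τ.Passes D (p ++ l'.flatMap φ ++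
        s)) :
    SatisfiesIdentity (syntacticCon (passSet D F)).Quotient
      (FreeMonoid.map ε (FreeMonoid.ofList l), FreeMonoid.map ε (FreeMonoid.ofList l')) := by
  rw [satisfiesIdentity_syntacticCon_iff]
  intro Φ p s
  have := h (fun g => (Φ (FreeMonoid.of (ε g))).toList) p.toList s.toList
  simp only [passSet, Set.mem_ofPred_eq, FreeMonoid.toList_mul, toList_map_free]
  exact this

/-- The noncritical tests that the base word passes. -/
def guardTests (R T : List Letter) : Set WordTest :=
  {τ | τ.Noncritical ∧ τ.Passes (cList R T) (baseWord R T)}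

theorem forall_insert_guardTests_iff {R T : List Letter} {τ : WordTest} {l : List DLetter} :
    (∀ σ ∈ insert τ (guardTests R T), σ.Passes (cList R T) l) ↔
      Guarded R T l ∧ τ.Passes (cList R T) l := by
  simp only [Set.mem_insert_iff, forall_eq_or_imp, guardTests, Set.mem_ofPred_eq, and_imp, Guarded]
  exact and_comm

theorem forall_union_guardTests_iff {R T : List Letter} {τ τ' : WordTest} {l : List DLetter} :
    (∀ σ ∈ insert τ (guardTests R T) ∪ insert τ' (guardTests R T), σ.Passes (cList R T) l) ↔
      (Guarded R T l ∧ τ.Passes (cList R T) l) ∧ τ'.Passes (cList R T) l := by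
  simp only [Set.mem_union, or_imp, forall_and, forall_insert_guardTests_iff]
  tauto

/-- For all `n ≥ 1` and `ρ ∈ S_n`, the lattice of subvarieties of the variety generated by
`M_λ([c_{0,0,n}[ρ]]^λ)` is not modular. -/
theorem mainTheorem10 (n : ℕ) (hn : 1 ≤ n) (ρ : SymGroup n) :
    ¬ IsModularLattice (MonoidVariety.SubvarietyLattice (varMLambda (cWord n ρ))) := by
  intro hmod
  obtain ⟨R, T, h, hD⟩ := exists_isCBlock n hn ρ
  obtain ⟨ε, hε⟩ := exists_injective_dLetter
  let D := (cWord n ρ).toList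
  let FA : Set WordTest := insert WordTest.projA (guardTests R T)
  let FB : Set WordTest := insert WordTest.projB (guardTests R T)
  let W : Bool → Bool → List DLetter := fun i j =>
    doubleWord R T (orderedPair .a i) (orderedPair .b j)
  let E : Bool → Bool → Word := fun i j => FreeMonoid.map ε (FreeMonoid.ofList (W i j))
  have hN : ∀ F, MonoidVariety.generatedBy (syntacticCon (passSet D F)).Quotient ≤
      varMLambda (cWord n ρ) := fun F =>
    MonoidVariety.generatedBy_le_iff.2 (syntacticCon_passSet_mem_varMLambda _ F)
  have hB : ∀ j, SatisfiesIdentity (syntacticCon (passSet D FB)).Quotient (E false j, E true j) :=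
    fun j => syntacticCon_passSet_map fun φ p s => by
      simp only [FB, D, hD, forall_insert_guardTests_iff]
      exact projB_left_iff φ p s h hn j
  have hA : ∀ i, SatisfiesIdentity (syntacticCon (passSet D FA)).Quotient (E i false, E i true) :=
    fun i => syntacticCon_passSet_map fun φ p s => by
      simp only [FA, D, hD, forall_insert_guardTests_iff]
      exact projA_right_iff φ p s h hn _
  -- The first projection is invariant under this interchange only given that the guard tests and
  -- the second projection are passed, so these are transported first.
  have hAB : SatisfiesIdentity (syntacticCon (passSet D (FB ∪ FA))).Quotient
      (E false true, E true true) :=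
    syntacticCon_passSet_map fun φ p s => by
      simp only [FA, FB, D, hD, forall_union_guardTests_iff]
      have h1 := projB_left_iff φ p s h hn true
      constructor
      · rintro ⟨h2, h3⟩
        exact ⟨h1.1 h2, (projA_left_iff φ p s h hn h2.1 h2.2).1 h3⟩
      · rintro ⟨h2, h3⟩
        exact ⟨h1.2 h2, (projA_left_iff φ p s h hn (h1.2 h2).1 (h1.2 h2).2).2 h3⟩
  let VC := MonoidVariety.generatedBy (syntacticCon (passSet D FB)).Quotient
  let VB := MonoidVariety.generatedBy (syntacticCon (passSet D FA)).Quotient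
  let VN := MonoidVariety.generatedBy (syntacticCon (passSet D (FB ∪ FA))).Quotient
  -- The modular law for VC ≤ VC ⊔ VN and VB, read off from the interval below the given variety.
  have hmod' : (VC ⊔ VB) ⊓ (VC ⊔ VN) ≤ VC ⊔ VB ⊓ (VC ⊔ VN) := by
    have := hmod.sup_inf_le_assoc_of_le
      (x := (⟨VC, hN _⟩ : Set.Iic (varMLambda (cWord n ρ)))) ⟨VB, hN _⟩
      (z := ⟨VC ⊔ VN, sup_le (hN _) (hN _)⟩) (show VC ≤ VC ⊔ VN from le_sup_left)
    exact this
  have h1 : VN ≤ VC ⊔ VB ⊓ (VC ⊔ VN) :=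
    (le_inf (MonoidVariety.generatedBy_le_iff.2 mem_sup_of_passSet_inter) le_sup_right).trans hmod'
  have h2 : VC ⊔ VB ⊓ (VC ⊔ VN) ≤ MonoidVariety.ofIdentity (E false false, E true false) := by
    refine sup_le (MonoidVariety.generatedBy_le_iff.2 (hB false)) fun M hM φ => ?_
    have hM1 : ∀ i, SatisfiesIdentity M (E i false, E i true) := fun i =>
      (MonoidVariety.generatedBy_le_iff.2 (hA i) :
        VB ≤ MonoidVariety.ofIdentity (E i false, E i true)) ((inf_le_left : VB ⊓ (VC ⊔ VN) ≤ VB)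
          hM)
    have hM2 : SatisfiesIdentity M (E false true, E true true) :=
      (sup_le (MonoidVariety.generatedBy_le_iff.2 (hB true))
        (MonoidVariety.generatedBy_le_iff.2 hAB) :
        VC ⊔ VN ≤ MonoidVariety.ofIdentity (E false true, E true true))
          ((inf_le_right : VB ⊓ (VC ⊔ VN) ≤ VC ⊔ VN) hM)
    -- The detour E(0,0) ≈ E(0,1) ≈ E(1,1) ≈ E(1,0).
    exact ((hM1 false φ).trans (hM2 φ)).trans (hM1 true φ).symm
  have h3 : SatisfiesIdentity (syntacticCon (passSet D (FB ∪ FA))).Quotient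
      (E false false, E true false) := MonoidVariety.generatedBy_le_iff.1 (h1.trans h2)
  rw [satisfiesIdentity_syntacticCon_iff] at h3
  -- Undoing the encoding ε with the empty context compares the words `W i j` themselves, and `W
  -- false false` is the base word.
  have h4 := h3 (FreeMonoid.map (Function.invFun ε)) 1 1
  have hinv : ∀ i j, FreeMonoid.map (Function.invFun ε) (E i j) = FreeMonoid.ofList (W i j) := by
    intro i j
    apply FreeMonoid.toList.injective
    simp only [E, FreeMonoid.toList_map, FreeMonoid.toList_ofList, List.map_map,
      Function.invFun_comp hε, List.map_id]
  simp only [one_mul, mul_one, hinv, passSet, Set.mem_ofPred_eq, FreeMonoid.toList_ofList,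
    FA, FB, D, hD, forall_union_guardTests_iff] at h4
  have h5 := (h4.1 ⟨⟨fun τ _ hτ => hτ, projB_passes R T⟩, projA_passes R T⟩).2
  refine h.not_y_x_t (WordTest.isProj_projA.sublist h5 (p := [.y, .x, .t]) ?_ (by simp))
  simp [W, orderedPair, doubleWord]
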